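/- Let $d\ge 1$ be an integer, $\nu>0$, $\alpha>0$, and let $K_\nu$ be the modified Bessel function of the second kind, i.e. $K_\nu(x)=\frac{\sqrt\pi}{\Gamma(\nu+1/2)}\left(\frac x2\right)^\nu\int_1^\infty e^{-xt}(t^2-1)^{\nu-1/2}\,dt$ for $x>0$. Let $C_0$ be the Whittle–Matérn covariance function $$C_0(x)=\rho\,\frac{2^{1-\nu}}{\Gamma(\nu)}\,\|x/\alpha\|^\nu K_\nu(\|x/\alpha\|),\quad x\in\mathbb R^d\setminus\{0\},\qquad C_0(0)=\rho,$$ where $\|\cdot\|$ is the Euclidean norm and $$0\le\rho\le\rho_{\max}=\frac{\Gamma(\nu)}{\Gamma(\nu+d/2)(2\sqrt\pi\,\alpha)^d}.$$ Let $\varphi(y)=\int_{\mathbb R^d}C_0(t)e^{-2\pi i\,y\cdot t}\,dt$ and $C_{\mathrm{app},0}(u)=\sum_{k\in\mathbb Z^d}\varphi(k)e^{2\pi i\,k\cdot u}$. Put $$\beta=\left(\alpha\sqrt d\,\max\{\Gamma(1+2\nu)^{1/(2\nu)},1\}\right)^{-1},$$ $$c(\rho,\nu,\alpha,d)=\begin{cases}(4\alpha)^{1-2\nu}\rho^2\pi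 d/\Gamma(\nu)^2&\text{if }\nu\le\frac12,\\ 4\nu^2\rho^2d&\text{if }\nu\ge\frac12,\end{cases}$$ $$\epsilon(\nu,\alpha,1)=\frac{e^{-\beta}}{\beta}+\frac{2e^{-\beta}}{1-e^{-\beta}}\left(\frac{e^{-\beta}}{\beta}+\frac1{1-e^{-\beta}}-1\right),$$ and, for $d\ge2$, $$\epsilon(\nu,\alpha,d)=e^{-\beta}\left(\frac1\beta+\frac2{(1-e^{-\beta})^2}-\frac12\right)\left(\frac1\beta+\frac{2e^{-\beta}}{1-e^{-\beta}}\left(\frac1\beta+\frac1{1-e^{-\beta}}\right)\right)^{d-1}.$$ Then $C_0$ is integrable on $\mathbb R^d$, the series defining $C_{\mathrm{app},0}(u)$ converges absolutely for every $u\in\mathbb R^d$, $|C_0-C_{\mathrm{app},0}|^2$ is integrable on $[-1/2,1/2]^d$, and $$\int_{[-1/2,1/2]^d}|C_0(x)-C_{\mathrm{app},0}(x)|^2\,dx\le c(\rho,\nu,\alpha,d)\,\epsilon(\nu,\alpha,d).$$ -/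

import Mathlib

open MeasureTheory
open scoped FourierTransform

noncomputable section

namespace WhittleMatern

/-- The modified Bessel function of the second kind `K_ν(x)`, for `ν > 0` and `x > 0`, through
its integral representation over `(1, ∞)`. -/
def besselK (ν x : ℝ) : ℝ :=
  Real.sqrt Real.pi / Real.Gamma (ν + 1 / 2) * (x / 2) ^ ν *
    ∫ t in Set.Ioi (1 : ℝ), Real.exp (-(x * t)) * (t ^ 2 - 1) ^ (ν - 1 / 2)

/-- The Whittle–Matérn covariance function with intensity `ρ`, shape `ν` and scale `α`;
its value at the origin is the limit `ρ`. -/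
def cov (d : ℕ) (ρ ν α : ℝ) (x : EuclideanSpace ℝ (Fin d)) : ℝ :=
  if x = 0 then ρ
  else ρ * (2 ^ (1 - ν) / Real.Gamma ν) * ‖α⁻¹ • x‖ ^ ν * besselK ν ‖α⁻¹ • x‖

/-- The maximal intensity. -/
def rhoMax (d : ℕ) (ν α : ℝ) : ℝ :=
  Real.Gamma ν / (Real.Gamma (ν + d / 2) * (2 * Real.sqrt Real.pi * α) ^ d)

/-- The spectral density `φ(y) = ∫ C₀(t) e^{-2πi y·t} dt`. -/
def spectralDensity (d : ℕ) (ρ ν α : ℝ) : EuclideanSpace ℝ (Fin d) → ℂ :=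
  𝓕 (fun t : EuclideanSpace ℝ (Fin d) => (cov d ρ ν α t : ℂ))

/-- An integer vector as a point of Euclidean space. -/
def latticePoint {d : ℕ} (k : Fin d → ℤ) : EuclideanSpace ℝ (Fin d) :=
  WithLp.toLp 2 fun i => (k i : ℝ)

/-- The `k`-th term `φ(k) e^{2πi k·u}` of the Fourier approximation. -/
def appTerm (d : ℕ) (ρ ν α : ℝ) (u : EuclideanSpace ℝ (Fin d)) (k : Fin d → ℤ) : ℂ :=
  spectralDensity d ρ ν α (latticePoint k) *
    Complex.exp (2 * Real.pi * Complex.I * (∑ i, (k i : ℝ) * u i : ℝ))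

/-- The Fourier approximation `C_{app,0}(u) = ∑_{k ∈ ℤ^d} φ(k) e^{2πi k·u}`. -/
def covApp (d : ℕ) (ρ ν α : ℝ) (u : EuclideanSpace ℝ (Fin d)) : ℂ :=
  ∑' k : Fin d → ℤ, appTerm d ρ ν α u k

/-- The unit cube `[-1/2, 1/2]^d`. -/
def unitCube (d : ℕ) : Set (EuclideanSpace ℝ (Fin d)) :=
  {x | ∀ i, x i ∈ Set.Icc (-(1 / 2) : ℝ) (1 / 2)}

/-- `β = (α √d (Γ(1+2ν)^{1/(2ν)} ∨ 1))⁻¹`. -/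
def beta (d : ℕ) (ν α : ℝ) : ℝ :=
  (α * Real.sqrt d * max (Real.Gamma (1 + 2 * ν) ^ (1 / (2 * ν))) 1)⁻¹

/-- The constant `c(ρ, ν, α, d)`; its two formulas agree at `ν = 1/2`. -/
def errorConst (d : ℕ) (ρ ν α : ℝ) : ℝ :=
  if ν ≤ 1 / 2 then (4 * α) ^ (1 - 2 * ν) * ρ ^ 2 * Real.pi * d / Real.Gamma ν ^ 2
  else 4 * ν ^ 2 * ρ ^ 2 * d

/-- `ε(ν, α, 1)` as a function of `β`. -/
def epsOne (b : ℝ) : ℝ :=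
  Real.exp (-b) / b + 2 * Real.exp (-b) / (1 - Real.exp (-b)) *
    (Real.exp (-b) / b + 1 / (1 - Real.exp (-b)) - 1)

/-- `ε(ν, α, d)`, `d ≥ 2`, as a function of `β` and `d`. -/
def epsMulti (d : ℕ) (b : ℝ) : ℝ :=
  Real.exp (-b) * (1 / b + 2 / (1 - Real.exp (-b)) ^ 2 - 1 / 2) *
    (1 / b + 2 * Real.exp (-b) / (1 - Real.exp (-b)) *
      (1 / b + 1 / (1 - Real.exp (-b)))) ^ (d - 1)

/-- `ε(ν, α, d)` for `d ≥ 1`. -/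
def eps (d : ℕ) (ν α : ℝ) : ℝ :=
  if d = 1 then epsOne (beta d ν α) else epsMulti d (beta d ν α)

end WhittleMatern

end

noncomputable section

namespace WhittleMatern

open Real Set Filter Topology

/-! The covariance is a Gamma mixture of Gaussians (`cov_eq_integral`): write `e^{-xt}` in the
Bessel integral as an inverse Gaussian mixture and integrate out `t`. Its Fourier transform is
therefore an explicit, positively weighted integral, summable over the lattice, and Poisson
summation for each Gaussian integrates to `C_app(x) = ∑ₙ C₀(x+n)` (`covApp_eq_tsum`). The error at
`x` is thus `-∑_{n≠0} C₀(x+n)`.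

On the cube every `x+n` with `n ≠ 0` has norm at least `1/2`, and there `C₀(y) ≤ √(c/d)
e^{-β∑|y_i|}` (`cov_le_exp`); for `ν > 1/2` this rests on Alzer's incomplete Gamma inequality. The
`ℓ¹` exponential factors over coordinates, so the error is at most `√(c/d) (P - Q)`, with `P = ∏
S(x_i)`, `Q = ∏ e^{-β|x_i|}` and `S` the periodised exponential.

For `d = 1` the square of `P - Q` is integrated exactly. For `d ≥ 2`, `0 ≤ Q ≤ P` gives `(P-Q)² ≤ P²
- PQ`, whose integral is `B^d - E^d` with `B = ∫S²` and `E = ∫S e^{-β|x|}`. Finally `B^d - E^d ≤ d A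
B^{d-1}`, `A` being `epsHead` (`sqMass_pow_sub_crossMass_pow_le`), and the factor `d` cancels. -/

/-! ### The inverse Gaussian integral -/

/-- The antiderivative of `e^{-t²}` vanishing at `0`. -/
def gaussPrim (x : ℝ) : ℝ := ∫ t in (0 : ℝ)..x, exp (-t ^ 2)

lemma hasDerivAt_gaussPrim (x : ℝ) : HasDerivAt gaussPrim (exp (-x ^ 2)) x := by
  have hc : Continuous fun t : ℝ => exp (-t ^ 2) := by fun_prop
  exact intervalIntegral.integral_hasDerivAt_right (hc.intervalIntegrable _ _)
    hc.stronglyMeasurable.stronglyMeasurableAtFilter hc.continuousAt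

lemma tendsto_gaussPrim_atTop : Tendsto gaussPrim atTop (𝓝 (√π / 2)) := by
  have h := intervalIntegral_tendsto_integral_Ioi (μ := volume) (f := fun t : ℝ => exp (-t ^ 2)) 0
    (by simpa using (integrable_exp_neg_mul_sq one_pos).integrableOn) tendsto_id
  have h2 := integral_gaussian_Ioi 1
  simp only [neg_mul, one_mul, div_one] at h2
  rw [h2] at h
  exact h

lemma gaussPrim_neg (x : ℝ) : gaussPrim (-x) = -gaussPrim x := by
  unfold gaussPrim
  have := intervalIntegral.integral_comp_neg (a := 0) (b := x) (fun t : ℝ => exp (-t ^ 2))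
  simp only [neg_zero, even_two, Even.neg_pow] at this
  rw [this, intervalIntegral.integral_symm]

lemma tendsto_gaussPrim_atBot : Tendsto gaussPrim atBot (𝓝 (-(√π / 2))) := by
  have h := (tendsto_gaussPrim_atTop.comp tendsto_neg_atBot_atTop).neg
  refine h.congr fun x => ?_
  simp [gaussPrim_neg]

/-- The antiderivative of the inverse Gaussian density used in `integral_inverseGaussian`. -/
def levyPrim (z s : ℝ) : ℝ :=
  exp (-z) * gaussPrim (√s - z / (2 * √s)) - exp z * gaussPrim (√s + z / (2 * √s))

/-- Since `(√s ∓ z/(2√s))² = s ∓ z + z²/(4s)`, the prefactors `e^{∓z}` give both terms the same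
exponential; the `1/(2√s)` parts of the inner derivatives cancel. -/
lemma hasDerivAt_levyPrim {z s : ℝ} (hs : 0 < s) :
    HasDerivAt (levyPrim z) (z / 2 * (s ^ (-(3 / 2) : ℝ) * exp (-s - z ^ 2 / (4 * s)))) s := by
  have hr : 0 < √s := sqrt_pos.2 hs
  have h1 := hasDerivAt_sqrt hs.ne'
  have h2 : HasDerivAt (fun s => z / (2 * √s)) (-(z / (4 * (s * √s)))) s := by
    have := (hasDerivAt_const s z).div (h1.const_mul 2) (by positivity)
    convert! this using 1
    have e : √s ^ 2 = s := sq_sqrt hs.le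
    field_simp
    rw [e]; ring
  have h3 := (((hasDerivAt_gaussPrim _).comp s (h1.sub h2)).const_mul (exp (-z))).sub
    (((hasDerivAt_gaussPrim _).comp s (h1.add h2)).const_mul (exp z))
  convert! h3 using 1
  have e : √s ^ 2 = s := sq_sqrt hs.le
  have e1 : exp (-z) * exp (-(√s - z / (2 * √s)) ^ 2) = exp (-s - z ^ 2 / (4 * s)) := by
    rw [← exp_add]; congr 1
    field_simp
    rw [e]; ring
  have e2 : exp z * exp (-(√s + z / (2 * √s)) ^ 2) = exp (-s - z ^ 2 / (4 * s)) := by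
    rw [← exp_add]; congr 1
    field_simp
    rw [e]; ring
  simp only [Pi.sub_apply, Pi.add_apply]
  rw [← mul_assoc (exp (-z)), e1, ← mul_assoc (exp z), e2,
    show (-(3 / 2) : ℝ) = -(1 + 1 / 2) by norm_num, rpow_neg hs.le, rpow_add hs, rpow_one, ← sqrt_eq_rpow]
  field_simp
  ring

lemma tendsto_levyPrim_atTop {z : ℝ} :
    Tendsto (levyPrim z) atTop (𝓝 (exp (-z) * (√π / 2) - exp z * (√π / 2))) := by
  have h0 : Tendsto (fun s : ℝ => z / (2 * √s)) atTop (𝓝 0) :=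
    tendsto_const_nhds.div_atTop (tendsto_sqrt_atTop.const_mul_atTop two_pos)
  refine Tendsto.sub (Tendsto.const_mul _ (tendsto_gaussPrim_atTop.comp ?_))
    (Tendsto.const_mul _ (tendsto_gaussPrim_atTop.comp ?_))
  · simpa [sub_eq_add_neg] using tendsto_sqrt_atTop.atTop_add h0.neg
  · exact tendsto_sqrt_atTop.atTop_add h0

lemma tendsto_levyPrim_zero {z : ℝ} (hz : 0 < z) :
    Tendsto (levyPrim z) (𝓝[>] 0) (𝓝 (exp (-z) * (-(√π / 2)) - exp z * (√π / 2))) := by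
  have hs : Tendsto (fun s : ℝ => √s) (𝓝[>] 0) (𝓝[>] 0) := by
    refine tendsto_nhdsWithin_iff.2 ⟨?_, ?_⟩
    · have := (continuous_sqrt.tendsto 0).mono_left (nhdsWithin_le_nhds (s := Ioi (0 : ℝ)))
      simpa using this
    · filter_upwards [self_mem_nhdsWithin] with s hs using sqrt_pos.2 hs
  have hi : Tendsto (fun s : ℝ => z / (2 * √s)) (𝓝[>] 0) atTop := by
    have := (tendsto_inv_nhdsGT_zero.comp hs).const_mul_atTop (half_pos hz)
    refine this.congr fun s => ?_
    simp only [Function.comp]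
    ring
  have h0 := tendsto_nhds_of_tendsto_nhdsWithin hs
  refine Tendsto.sub (Tendsto.const_mul _ (tendsto_gaussPrim_atBot.comp ?_))
    (Tendsto.const_mul _ (tendsto_gaussPrim_atTop.comp ?_))
  · exact h0.add_atBot (tendsto_neg_atTop_atBot.comp hi)
  · exact h0.add_atTop hi

/-- The inverse Gaussian subordination formula for the exponential. -/
lemma integral_inverseGaussian {z : ℝ} (hz : 0 < z) :
    IntegrableOn (fun s : ℝ => s ^ (-(3 / 2) : ℝ) * exp (-s - z ^ 2 / (4 * s))) (Ioi 0) ∧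
      ∫ s in Ioi (0 : ℝ), s ^ (-(3 / 2) : ℝ) * exp (-s - z ^ 2 / (4 * s)) =
        2 * √π * exp (-z) / z := by
  set l := exp (-z) * (-(√π / 2)) - exp z * (√π / 2) with hl
  -- Division by zero gives `levyPrim z 0` the value `0`, so the true limit `l` is inserted at the
  -- origin.
  have hcont : ContinuousWithinAt (Function.update (levyPrim z) 0 l) (Ici 0) 0 := by
    rw [continuousWithinAt_update_same, Ici_sdiff_left]
    exact tendsto_levyPrim_zero hz
  have hderiv : ∀ s ∈ Ioi (0 : ℝ), HasDerivAt (Function.update (levyPrim z) 0 l)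
      (z / 2 * (s ^ (-(3 / 2) : ℝ) * exp (-s - z ^ 2 / (4 * s)))) s := fun s hs =>
    (hasDerivAt_levyPrim hs).congr_of_eventuallyEq <| by
      filter_upwards [isOpen_ne.mem_nhds (ne_of_gt hs)] with t ht
      exact Function.update_of_ne ht _ _
  have hnn : ∀ s ∈ Ioi (0 : ℝ), 0 ≤ z / 2 * (s ^ (-(3 / 2) : ℝ) * exp (-s - z ^ 2 / (4 * s))) :=
    fun s hs => by have : 0 < s := hs; positivity
  have hlim : Tendsto (Function.update (levyPrim z) 0 l) atTop
      (𝓝 (exp (-z) * (√π / 2) - exp z * (√π / 2))) :=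
    tendsto_levyPrim_atTop.congr' <| by
      filter_upwards [eventually_gt_atTop 0] with t ht
      exact (Function.update_of_ne ht.ne' _ _).symm
  have hInt := integrableOn_Ioi_deriv_of_nonneg hcont hderiv hnn hlim
  have hval := integral_Ioi_of_hasDerivAt_of_nonneg hcont hderiv hnn hlim
  constructor
  · have := hInt.const_mul (2 / z)
    refine this.congr (ae_of_all _ fun s => ?_)
    field_simp
  · rw [integral_const_mul, Function.update_self, hl] at hval
    rw [eq_div_iff hz.ne']
    linarith

/-! ### The Bessel integral as a mixture -/

lemma integrableOn_rpow_mul_exp_neg_mul {a r : ℝ} (ha : 0 < a) (hr : 0 < r) :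
    IntegrableOn (fun t : ℝ => t ^ (a - 1) * exp (-(r * t))) (Ioi 0) := by
  -- The integral of a non-integrable function is `0` by convention, so a nonzero value forces
  -- integrability.
  refine Integrable.of_integral_ne_zero ?_
  rw [integral_rpow_mul_exp_neg_mul_Ioi ha hr]
  have := Gamma_pos_of_pos ha
  positivity

lemma lintegral_rpow_mul_exp_neg_mul {a r : ℝ} (ha : 0 < a) (hr : 0 < r) :
    ∫⁻ t in Ioi (0 : ℝ), ENNReal.ofReal (t ^ (a - 1) * exp (-(r * t))) =
      ENNReal.ofReal (r ^ (-a) * Gamma a) := by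
  rw [← ofReal_integral_eq_lintegral_ofReal (integrableOn_rpow_mul_exp_neg_mul ha hr),
    integral_rpow_mul_exp_neg_mul_Ioi ha hr, one_div, inv_rpow hr.le, rpow_neg hr.le]
  filter_upwards [ae_restrict_mem measurableSet_Ioi] with t ht
  have : 0 < t := ht
  positivity

/-- The substitution `w = t² - 1` turns this into a Gamma integral. -/
lemma lintegral_mul_sq_sub_one_rpow_mul_exp {c m : ℝ} (hc : 0 < c) (hm : 0 < m) :
    ∫⁻ t in Ioi (1 : ℝ), ENNReal.ofReal (t * (t ^ 2 - 1) ^ (m - 1) * exp (-(c * t ^ 2))) =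
      ENNReal.ofReal (exp (-c) / 2 * (c ^ (-m) * Gamma m)) := by
  have himg : (fun t : ℝ => t ^ 2 - 1) '' Ioi 1 = Ioi 0 := by
    ext w
    constructor
    · rintro ⟨t, ht, rfl⟩
      have : 1 < t := ht
      simp only [mem_Ioi]; nlinarith
    · intro hw
      have hw : 0 < w := hw
      refine ⟨√(w + 1), ?_, ?_⟩
      · rw [mem_Ioi, lt_sqrt zero_le_one]; linarith
      · simp only; rw [sq_sqrt (by linarith)]; ring
  have hd : ∀ t ∈ Ioi (1 : ℝ), HasDerivWithinAt (fun t : ℝ => t ^ 2 - 1) (2 * t) (Ioi 1) t :=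
    fun t _ => by simpa using ((hasDerivAt_pow 2 t).sub_const 1).hasDerivWithinAt
  have hmono : MonotoneOn (fun t : ℝ => t ^ 2 - 1) (Ioi 1) := by
    intro s hs t ht hst
    have : 1 < s := hs
    simp only; nlinarith
  have h := lintegral_image_eq_lintegral_deriv_mul_of_monotoneOn measurableSet_Ioi hd hmono
    (fun w => ENNReal.ofReal (exp (-c) / 2) * ENNReal.ofReal (w ^ (m - 1) * exp (-(c * w))))
  rw [himg, lintegral_const_mul' _ _ ENNReal.ofReal_ne_top, lintegral_rpow_mul_exp_neg_mul hm hc,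
    ← ENNReal.ofReal_mul (by positivity)] at h
  rw [h]
  refine setLIntegral_congr_fun measurableSet_Ioi fun t ht => ?_
  have ht : 1 < t := ht
  have h1 : 0 < t ^ 2 - 1 := by nlinarith
  rw [← ENNReal.ofReal_mul (by positivity), ← ENNReal.ofReal_mul (by positivity)]
  congr 1
  rw [show -(c * t ^ 2) = -c + -(c * (t ^ 2 - 1)) by ring, exp_add]
  ring

lemma ofReal_exp_neg_eq_lintegral {z : ℝ} (hz : 0 < z) :
    ENNReal.ofReal (exp (-z)) = ∫⁻ s in Ioi (0 : ℝ),
      ENNReal.ofReal (z / (2 * √π) * (s ^ (-(3 / 2) : ℝ) * exp (-s - z ^ 2 / (4 * s)))) := by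
  obtain ⟨h1, h2⟩ := integral_inverseGaussian hz
  rw [← ofReal_integral_eq_lintegral_ofReal (h1.const_mul _), integral_const_mul, h2]
  · congr 1
    field_simp
  · filter_upwards [ae_restrict_mem measurableSet_Ioi] with t ht
    have : 0 < t := ht
    positivity

/-- Expand `e^{-xt}` by inverse Gaussian subordination and integrate over `t` first. In `[0, ∞]`
Tonelli needs no integrability. -/
lemma lintegral_exp_neg_mul_sq_sub_one_rpow {x m : ℝ} (hx : 0 < x) (hm : 0 < m) :
    ∫⁻ t in Ioi (1 : ℝ), ENNReal.ofReal (exp (-(x * t)) * (t ^ 2 - 1) ^ (m - 1)) =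
      ENNReal.ofReal (x / (4 * √π) * (x ^ 2 / 4) ^ (-m) * Gamma m) *
      ∫⁻ s in Ioi (0 : ℝ), ENNReal.ofReal (s ^ (m - 3 / 2) * exp (-s - x ^ 2 / (4 * s))) := by
  have hG := Gamma_pos_of_pos hm
  calc
    _ = ∫⁻ t in Ioi (1 : ℝ), ∫⁻ s in Ioi (0 : ℝ), ENNReal.ofReal ((t ^ 2 - 1) ^ (m - 1) *
        ((x * t) / (2 * √π) * (s ^ (-(3 / 2) : ℝ) * exp (-s - (x * t) ^ 2 / (4 * s))))) := by
      refine setLIntegral_congr_fun measurableSet_Ioi fun t ht => ?_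
      have ht : 1 < t := ht
      have h1 : 0 < t ^ 2 - 1 := by nlinarith
      rw [mul_comm, ENNReal.ofReal_mul (by positivity), ofReal_exp_neg_eq_lintegral (by positivity),
        ← lintegral_const_mul' _ _ ENNReal.ofReal_ne_top]
      simp_rw [← ENNReal.ofReal_mul (rpow_nonneg h1.le (m - 1))]
    _ = ∫⁻ s in Ioi (0 : ℝ), ∫⁻ t in Ioi (1 : ℝ), ENNReal.ofReal ((t ^ 2 - 1) ^ (m - 1) *
        ((x * t) / (2 * √π) * (s ^ (-(3 / 2) : ℝ) * exp (-s - (x * t) ^ 2 / (4 * s))))) := by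
      refine lintegral_lintegral_swap (Measurable.aemeasurable ?_)
      unfold Function.uncurry
      fun_prop
    _ = ∫⁻ s in Ioi (0 : ℝ), ENNReal.ofReal (x / (4 * √π) * (x ^ 2 / 4) ^ (-m) * Gamma m) *
        ENNReal.ofReal (s ^ (m - 3 / 2) * exp (-s - x ^ 2 / (4 * s))) := by
      refine setLIntegral_congr_fun measurableSet_Ioi fun s hs => ?_
      have hs : 0 < s := hs
      have hc : 0 < x ^ 2 / (4 * s) := by positivity
      calc
        _ = ∫⁻ t in Ioi (1 : ℝ), ENNReal.ofReal (x / (2 * √π) * (s ^ (-(3 / 2) : ℝ) * exp (-s))) *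
            ENNReal.ofReal (t * (t ^ 2 - 1) ^ (m - 1) * exp (-(x ^ 2 / (4 * s) * t ^ 2))) := by
          refine setLIntegral_congr_fun measurableSet_Ioi fun t ht => ?_
          rw [← ENNReal.ofReal_mul (by positivity)]
          congr 1
          rw [show -s - (x * t) ^ 2 / (4 * s) = -s + -(x ^ 2 / (4 * s) * t ^ 2) by ring, exp_add]
          ring
        _ = _ := by
          rw [lintegral_const_mul' _ _ ENNReal.ofReal_ne_top,
            lintegral_mul_sq_sub_one_rpow_mul_exp hc hm, ← ENNReal.ofReal_mul (by positivity),
            ← ENNReal.ofReal_mul (by positivity)]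
          congr 1
          have e1 : (x ^ 2 / (4 * s)) ^ (-m) = (x ^ 2 / 4) ^ (-m) * s ^ m := by
            rw [show x ^ 2 / (4 * s) = x ^ 2 / 4 * s⁻¹ by field_simp,
              mul_rpow (by positivity) (by positivity), inv_rpow hs.le, rpow_neg hs.le, inv_inv]
          rw [e1, sub_eq_add_neg (-s), exp_add, sub_eq_add_neg m, rpow_add hs]
          ring
    _ = _ := lintegral_const_mul' _ _ ENNReal.ofReal_ne_top

lemma integral_exp_neg_mul_sq_sub_one_rpow {x m : ℝ} (hx : 0 < x) (hm : 0 < m) :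
    ∫ t in Ioi (1 : ℝ), exp (-(x * t)) * (t ^ 2 - 1) ^ (m - 1) =
      x / (4 * √π) * (x ^ 2 / 4) ^ (-m) * Gamma m *
      ∫ s in Ioi (0 : ℝ), s ^ (m - 3 / 2) * exp (-s - x ^ 2 / (4 * s)) := by
  rw [integral_eq_lintegral_of_nonneg_ae, integral_eq_lintegral_of_nonneg_ae,
    lintegral_exp_neg_mul_sq_sub_one_rpow hx hm, ENNReal.toReal_mul, ENNReal.toReal_ofReal]
  · have := Gamma_pos_of_pos hm
    positivity
  · filter_upwards [ae_restrict_mem measurableSet_Ioi] with t ht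
    have : 0 < t := ht
    positivity
  · exact Measurable.aestronglyMeasurable (by fun_prop)
  · filter_upwards [ae_restrict_mem measurableSet_Ioi] with t ht
    have ht : 1 < t := ht
    have h1 : 0 < t ^ 2 - 1 := by nlinarith
    positivity
  · exact Measurable.aestronglyMeasurable (by fun_prop)

/-! ### Gamma mixture and spectral density -/

/-- The density, up to `Γ(ν)`, of the Gamma distribution mixing the Gaussians. -/
def mixWeight (ν s : ℝ) : ℝ := s ^ (ν - 1) * exp (-s)

lemma mixWeight_nonneg (ν : ℝ) {s : ℝ} (hs : 0 < s) : 0 ≤ mixWeight ν s := by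
  unfold mixWeight; positivity

lemma integrableOn_mixWeight {ν : ℝ} (hν : 0 < ν) : IntegrableOn (mixWeight ν) (Ioi 0) := by
  simpa [mixWeight] using! integrableOn_rpow_mul_exp_neg_mul hν one_pos

@[fun_prop]
lemma measurable_mixWeight (ν : ℝ) : Measurable (mixWeight ν) := by
  unfold mixWeight; fun_prop

/-- The Whittle–Matérn covariance as a Gamma mixture of Gaussians. -/
lemma cov_eq_integral {d : ℕ} {ρ ν α : ℝ} (hν : 0 < ν) (hα : 0 < α)
    (x : EuclideanSpace ℝ (Fin d)) :
    cov d ρ ν α x = ρ / Gamma ν *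
      ∫ s in Ioi (0 : ℝ), mixWeight ν s * exp (-(4 * α ^ 2 * s)⁻¹ * ‖x‖ ^ 2) := by
  have hG := Gamma_pos_of_pos hν
  unfold cov
  split_ifs with hx
  · subst hx
    have : ∫ s in Ioi (0 : ℝ), mixWeight ν s = Gamma ν := by
      have := integral_rpow_mul_exp_neg_mul_Ioi hν one_pos
      simpa [mixWeight] using this
    simp only [norm_zero, ne_eq, OfNat.ofNat_ne_zero, not_false_eq_true, zero_pow, mul_zero,
      exp_zero, mul_one, this]
    field_simp
  · have hr : 0 < ‖α⁻¹ • x‖ := norm_pos_iff.2 (by simp [hx, hα.ne'])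
    have hrx : ‖α⁻¹ • x‖ = ‖x‖ / α := by
      rw [norm_smul, norm_inv, norm_of_nonneg hα.le]; field_simp
    have hI : ∫ s in Ioi (0 : ℝ), mixWeight ν s * exp (-(4 * α ^ 2 * s)⁻¹ * ‖x‖ ^ 2) =
        ∫ s in Ioi (0 : ℝ), s ^ (ν + 1 / 2 - 3 / 2) * exp (-s - ‖α⁻¹ • x‖ ^ 2 / (4 * s)) := by
      refine setIntegral_congr_fun measurableSet_Ioi fun s hs => ?_
      have hs : 0 < s := hs
      simp only [mixWeight]
      rw [mul_assoc, ← exp_add, hrx]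
      congr 2
      · ring
      · field_simp
        ring
    rw [hI]
    generalize hrr : ‖α⁻¹ • x‖ = r at *
    unfold besselK
    have hJ := integral_exp_neg_mul_sq_sub_one_rpow hr (m := ν + 1 / 2) (by linarith)
    rw [show ν + 1 / 2 - 1 = ν - 1 / 2 by ring] at hJ
    rw [hJ]
    generalize ∫ s in Ioi (0 : ℝ), s ^ (ν + 1 / 2 - 3 / 2) * exp (-s - r ^ 2 / (4 * s)) = J
    have hG2 := Gamma_pos_of_pos (show 0 < ν + 1 / 2 by linarith)
    have e1 : (r ^ 2 / 4) ^ (-(ν + 1 / 2)) = (r / 2) ^ (-(2 * ν + 1)) := by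
      rw [show r ^ 2 / 4 = (r / 2) ^ (2 : ℝ) by rw [rpow_two]; ring, ← rpow_mul (by positivity)]
      congr 1; ring
    have e2 : r ^ ν = (r / 2) ^ ν * 2 ^ ν := by
      rw [← mul_rpow (by positivity) (by positivity)]; congr 1; ring
    have e3 : (r / 2) ^ (-(2 * ν + 1)) = ((r / 2) ^ ν * (r / 2) ^ ν * (r / 2))⁻¹ := by
      rw [rpow_neg (by positivity), two_mul, rpow_add (by positivity), rpow_add (by positivity),
        rpow_one]
    have e4 : (2 : ℝ) ^ (1 - ν) = 2 / 2 ^ ν := by rw [rpow_sub two_pos, rpow_one]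
    rw [e1, e3, e2, e4]
    field_simp
    norm_num

lemma integral_exp_neg_inv_mul_sq_norm {d : ℕ} {α s : ℝ} (hα : 0 < α) (hs : 0 < s) :
    ∫ x : EuclideanSpace ℝ (Fin d), exp (-(4 * α ^ 2 * s)⁻¹ * ‖x‖ ^ 2) =
      (4 * π * α ^ 2 * s) ^ (d / 2 : ℝ) := by
  rw [GaussianFourier.integral_rexp_neg_mul_sq_norm (by positivity)]
  simp only [finrank_euclideanSpace, Fintype.card_fin]
  congr 1
  field_simp

lemma integrable_exp_neg_inv_mul_sq_norm {d : ℕ} {α s : ℝ} (hα : 0 < α) (hs : 0 < s) :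
    Integrable fun x : EuclideanSpace ℝ (Fin d) => exp (-(4 * α ^ 2 * s)⁻¹ * ‖x‖ ^ 2) := by
  refine Integrable.of_integral_ne_zero ?_
  rw [integral_exp_neg_inv_mul_sq_norm hα hs]
  positivity

lemma mixWeight_mul_rpow {ν c e κ s : ℝ} (hc : 0 ≤ c) (hs : 0 < s) :
    mixWeight ν s * ((c * s) ^ e * exp (-(κ * s))) =
      c ^ e * (s ^ (ν + e - 1) * exp (-((1 + κ) * s))) := by
  unfold mixWeight
  rw [mul_rpow hc hs.le, show -((1 + κ) * s) = -s + -(κ * s) by ring, exp_add,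
    show ν + e - 1 = ν - 1 + e by ring, rpow_add hs]
  ring

lemma integrableOn_mixWeight_mul_rpow {ν c e κ : ℝ} (hc : 0 ≤ c) (he : 0 < ν + e) (hκ : 0 ≤ κ) :
    IntegrableOn (fun s => mixWeight ν s * ((c * s) ^ e * exp (-(κ * s)))) (Ioi 0) := by
  refine ((integrableOn_rpow_mul_exp_neg_mul he (by linarith : 0 < 1 + κ)).const_mul
    (c ^ e)).congr ?_
  filter_upwards [ae_restrict_mem measurableSet_Ioi] with s hs
  exact (mixWeight_mul_rpow hc hs).symm

lemma integral_mixWeight_mul_rpow {ν c e κ : ℝ} (hc : 0 ≤ c) (he : 0 < ν + e) (hκ : 0 ≤ κ) :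
    ∫ s in Ioi (0 : ℝ), mixWeight ν s * ((c * s) ^ e * exp (-(κ * s))) =
      c ^ e * ((1 + κ) ^ (-(ν + e)) * Gamma (ν + e)) := by
  rw [setIntegral_congr_fun measurableSet_Ioi fun s hs => mixWeight_mul_rpow hc hs,
    integral_const_mul, integral_rpow_mul_exp_neg_mul_Ioi he (by linarith), one_div,
    inv_rpow (by linarith), rpow_neg (by linarith)]

/-- This licenses Fubini for both the integrability and the Fourier transform of the covariance.
Integrating out space leaves a constant times `s^{ν+d/2-1} e^{-s}`. -/
lemma integrable_mixture {d : ℕ} {ν α : ℝ} (hν : 0 < ν) (hα : 0 < α) :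
    Integrable (fun p : EuclideanSpace ℝ (Fin d) × ℝ =>
      mixWeight ν p.2 * exp (-(4 * α ^ 2 * p.2)⁻¹ * ‖p.1‖ ^ 2))
      (volume.prod (volume.restrict (Ioi 0))) := by
  rw [integrable_prod_iff' (Measurable.aestronglyMeasurable (by fun_prop))]
  constructor
  · filter_upwards [ae_restrict_mem measurableSet_Ioi] with s hs
    exact (integrable_exp_neg_inv_mul_sq_norm hα hs).const_mul _
  · refine (integrableOn_mixWeight_mul_rpow (c := 4 * π * α ^ 2) (e := d / 2) (κ := 0)
      (by positivity) (by positivity) le_rfl).congr ?_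
    filter_upwards [ae_restrict_mem measurableSet_Ioi] with s hs
    simp only [norm_mul, norm_of_nonneg (mixWeight_nonneg ν hs), norm_of_nonneg (exp_pos _).le]
    rw [integral_const_mul, integral_exp_neg_inv_mul_sq_norm hα hs]
    simp

lemma integrable_cov {d : ℕ} {ρ ν α : ℝ} (hν : 0 < ν) (hα : 0 < α) :
    Integrable (cov d ρ ν α) := by
  have h := ((integrable_mixture (d := d) hν hα).integral_prod_left).const_mul (ρ / Gamma ν)
  refine h.congr (ae_of_all _ fun x => ?_)
  exact (cov_eq_integral hν hα x).symm

lemma fourier_gaussian_scaled {d : ℕ} {α s : ℝ} (hα : 0 < α) (hs : 0 < s)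
    (w : EuclideanSpace ℝ (Fin d)) :
    ∫ v : EuclideanSpace ℝ (Fin d), Complex.exp (↑(-2 * π * inner ℝ v w) * Complex.I) *
        ((exp (-(4 * α ^ 2 * s)⁻¹ * ‖v‖ ^ 2) : ℝ) : ℂ) =
      (((4 * π * α ^ 2 * s) ^ (d / 2 : ℝ) * exp (-(4 * π ^ 2 * α ^ 2 * ‖w‖ ^ 2 * s)) : ℝ) : ℂ) := by
  have hb : 0 < (((4 * α ^ 2 * s)⁻¹ : ℝ) : ℂ).re := by
    rw [Complex.ofReal_re]; positivity
  have h := fourier_gaussian_innerProductSpace (V := EuclideanSpace ℝ (Fin d)) hb w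
  rw [fourier_eq'] at h
  simp only [smul_eq_mul] at h
  rw [Complex.ofReal_mul, Complex.ofReal_exp, Complex.ofReal_cpow (by positivity)]
  convert! h using 1
  · congr 1; ext v
    push_cast
    rfl
  · simp only [finrank_euclideanSpace, Fintype.card_fin]
    have : (α : ℂ) ≠ 0 := by exact_mod_cast hα.ne'
    have : (s : ℂ) ≠ 0 := by exact_mod_cast hs.ne'
    congr 2
    · push_cast; field_simp
    · push_cast; rfl
    · push_cast; field_simp

lemma spectralDensity_eq_integral {d : ℕ} {ρ ν α : ℝ} (hν : 0 < ν) (hα : 0 < α)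
    (w : EuclideanSpace ℝ (Fin d)) :
    spectralDensity d ρ ν α w = ((ρ / Gamma ν * ∫ s in Ioi (0 : ℝ), mixWeight ν s *
      ((4 * π * α ^ 2 * s) ^ (d / 2 : ℝ) * exp (-(4 * π ^ 2 * α ^ 2 * ‖w‖ ^ 2 * s))) : ℝ) : ℂ) := by
  have hInt := ((integrable_mixture (d := d) hν hα).ofReal (𝕜 := ℂ)).bdd_mul (c := 1)
    (f := fun p => Complex.exp (↑(-2 * π * inner ℝ p.1 w) * Complex.I))
    (Measurable.aestronglyMeasurable (by fun_prop))
    (ae_of_all _ fun p => (Complex.norm_exp_ofReal_mul_I _).le)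
  have hswap := integral_integral_swap (f := fun v s => Complex.exp (↑(-2 * π * inner ℝ v w) *
    Complex.I) * ((mixWeight ν s * exp (-(4 * α ^ 2 * s)⁻¹ * ‖v‖ ^ 2) : ℝ) : ℂ)) hInt
  calc spectralDensity d ρ ν α w
      = ∫ v : EuclideanSpace ℝ (Fin d), ((ρ / Gamma ν : ℝ) : ℂ) * ∫ s in Ioi (0 : ℝ),
          Complex.exp (↑(-2 * π * inner ℝ v w) * Complex.I) *
          ((mixWeight ν s * exp (-(4 * α ^ 2 * s)⁻¹ * ‖v‖ ^ 2) : ℝ) : ℂ) := by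
        unfold spectralDensity
        rw [fourier_eq']
        congr 1; ext v
        rw [cov_eq_integral hν hα, integral_const_mul, integral_complex_ofReal, smul_eq_mul]
        push_cast
        ring
    _ = _ := by
        rw [integral_const_mul, hswap, Complex.ofReal_mul, ← integral_complex_ofReal]
        congr 1
        refine setIntegral_congr_fun measurableSet_Ioi fun s hs => ?_
        rw [Complex.ofReal_mul (mixWeight ν s), ← fourier_gaussian_scaled hα hs w,
          ← integral_const_mul]
        congr 1; ext v
        push_cast
        ring

lemma spectralDensity_eq {d : ℕ} {ρ ν α : ℝ} (hν : 0 < ν) (hα : 0 < α)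
    (w : EuclideanSpace ℝ (Fin d)) :
    spectralDensity d ρ ν α w = ((ρ / Gamma ν * ((4 * π * α ^ 2) ^ (d / 2 : ℝ) *
      ((1 + 4 * π ^ 2 * α ^ 2 * ‖w‖ ^ 2) ^ (-(ν + d / 2)) * Gamma (ν + d / 2))) : ℝ) : ℂ) := by
  rw [spectralDensity_eq_integral hν hα, integral_mixWeight_mul_rpow (by positivity)
    (by positivity) (by positivity)]

/-! ### Summability over the lattice -/

/-- Families absolutely summable in each coordinate have absolutely summable products. -/
lemma hasSum_prod_fin {R : Type*} [NormedField R] [CompleteSpace R] :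
    ∀ {d : ℕ} {f : Fin d → ℤ → R}, (∀ i, Summable fun n => ‖f i n‖) →
      (Summable fun n : Fin d → ℤ => ‖∏ i, f i (n i)‖) ∧
        HasSum (fun n : Fin d → ℤ => ∏ i, f i (n i)) (∏ i, ∑' n, f i n) := by
  intro d
  induction d with
  | zero =>
    intro f _
    simp only [Finset.univ_eq_empty, Finset.prod_empty]
    exact ⟨(hasSum_unique _).summable, hasSum_unique (fun _ : Fin 0 → ℤ => (1 : R))⟩
  | succ d ih =>
    intro f hf
    obtain ⟨h1, h2⟩ := ih (f := fun i => f i.succ) fun i => hf _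
    have hs := summable_mul_of_summable_norm (hf 0) h1
    have hn := (hf 0).mul_norm h1
    have ht := (hf 0).of_norm.hasSum.mul h2 hs
    rw [Fin.prod_univ_succ]
    constructor
    · rw [← (Fin.consEquiv fun _ : Fin (d + 1) => ℤ).summable_iff]
      refine hn.congr fun p => ?_
      simp [Fin.prod_univ_succ, Fin.consEquiv]
    · rw [← (Fin.consEquiv fun _ : Fin (d + 1) => ℤ).hasSum_iff]
      refine ht.congr_fun fun p => ?_
      simp [Fin.prod_univ_succ, Fin.consEquiv]

lemma summable_one_add_mul_sq_rpow {c p : ℝ} (hc : 0 < c) (hp : 1 / 2 < p) :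
    Summable fun n : ℤ => (1 + c * (n : ℝ) ^ 2) ^ (-p) := by
  have h := (Real.summable_abs_int_rpow (b := 2 * p) (by linarith)).mul_left (c ^ (-p))
  refine Summable.of_norm_bounded_eventually h ?_
  filter_upwards [(Set.finite_singleton (0 : ℤ)).eventually_cofinite_notMem] with n hn
  have hn' : (n : ℝ) ≠ 0 := by simpa using hn
  have h0 : 0 < c * (n : ℝ) ^ 2 := by positivity
  rw [norm_of_nonneg (by positivity)]
  calc (1 + c * (n : ℝ) ^ 2) ^ (-p) ≤ (c * (n : ℝ) ^ 2) ^ (-p) :=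
        rpow_le_rpow_of_nonpos h0 (by linarith) (by linarith)
    _ = _ := by
        rw [mul_rpow hc.le (by positivity), ← sq_abs, ← rpow_two, ← rpow_mul (abs_nonneg _)]
        congr 2; ring

lemma norm_latticePoint_sq {d : ℕ} (k : Fin d → ℤ) : ‖latticePoint k‖ ^ 2 = ∑ i, (k i : ℝ) ^ 2 := by
  simp [EuclideanSpace.norm_sq_eq, latticePoint]

/-- Split the power into `d` equal factors of exponent `-(ν/d + 1/2)` and keep one coordinate in
each: the majorant is a product of one-dimensional series, convergent because `ν/d + 1/2 > 1/2`. -/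
lemma summable_one_add_mul_norm_sq_rpow {d : ℕ} (hd : 1 ≤ d) {c ν : ℝ} (hc : 0 < c) (hν : 0 < ν) :
    Summable fun k : Fin d → ℤ => (1 + c * ‖latticePoint k‖ ^ 2) ^ (-(ν + d / 2)) := by
  have hd' : (0 : ℝ) < d := by exact_mod_cast hd
  have hp : 1 / 2 < ν / d + 1 / 2 := by have := div_pos hν hd'; linarith
  have h := (hasSum_prod_fin (d := d) (f := fun _ n => (1 + c * (n : ℝ) ^ 2) ^ (-(ν / d + 1 / 2)))
    fun _ => (summable_one_add_mul_sq_rpow hc hp).norm).1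
  refine Summable.of_nonneg_of_le (fun k => by positivity) (fun k => ?_) h
  rw [norm_of_nonneg (Finset.prod_nonneg fun i _ => by positivity), norm_latticePoint_sq]
  have hk : 0 < 1 + c * ∑ i, (k i : ℝ) ^ 2 := by
    have : 0 ≤ ∑ i, (k i : ℝ) ^ 2 := Finset.sum_nonneg fun i _ => sq_nonneg _
    positivity
  calc (1 + c * ∑ i, (k i : ℝ) ^ 2) ^ (-(ν + d / 2))
      = ∏ _i : Fin d, (1 + c * ∑ i, (k i : ℝ) ^ 2) ^ (-(ν / d + 1 / 2)) := by
        rw [Finset.prod_const, Finset.card_univ, Fintype.card_fin, ← rpow_natCast,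
          ← rpow_mul hk.le]
        congr 1
        field_simp
    _ ≤ _ := by
        refine Finset.prod_le_prod (fun i _ => by positivity) fun i _ => ?_
        refine rpow_le_rpow_of_nonpos (by positivity) ?_ (by linarith)
        gcongr
        exact Finset.single_le_sum (f := fun i => (k i : ℝ) ^ 2) (fun i _ => sq_nonneg _)
          (Finset.mem_univ i)

lemma norm_appTerm {d : ℕ} {ρ ν α : ℝ} (u : EuclideanSpace ℝ (Fin d)) (k : Fin d → ℤ) :
    ‖appTerm d ρ ν α u k‖ = ‖spectralDensity d ρ ν α (latticePoint k)‖ := by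
  unfold appTerm
  rw [norm_mul, show (2 * π * Complex.I * (∑ i, (k i : ℝ) * u i : ℝ) : ℂ) =
    ((2 * π * ∑ i, (k i : ℝ) * u i : ℝ) : ℂ) * Complex.I by push_cast; ring,
    Complex.norm_exp_ofReal_mul_I, mul_one]

lemma summable_norm_spectralDensity {d : ℕ} (hd : 1 ≤ d) {ρ ν α : ℝ} (hν : 0 < ν) (hα : 0 < α) :
    Summable fun k : Fin d → ℤ => ‖spectralDensity d ρ ν α (latticePoint k)‖ := by
  have h := summable_one_add_mul_norm_sq_rpow hd (c := 4 * π ^ 2 * α ^ 2) (by positivity) hν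
  refine ((h.mul_right (Gamma (ν + d / 2))).mul_left ((4 * π * α ^ 2) ^ (d / 2 : ℝ))
    |>.mul_left (ρ / Gamma ν)).norm.congr fun k => ?_
  rw [spectralDensity_eq hν hα, Complex.norm_real]

lemma summable_appTerm {d : ℕ} (hd : 1 ≤ d) {ρ ν α : ℝ} (hν : 0 < ν) (hα : 0 < α)
    (u : EuclideanSpace ℝ (Fin d)) : Summable (appTerm d ρ ν α u) :=
  Summable.of_norm <| (summable_norm_spectralDensity hd hν hα).congr fun k =>
    (norm_appTerm u k).symm

/-! ### Poisson summation -/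

lemma summable_norm_exp_theta {a : ℝ} (ha : 0 < a) (t : ℝ) :
    Summable fun k : ℤ => ‖Complex.exp (-π * a * k ^ 2 + 2 * π * (Complex.I * t) * k)‖ := by
  have h := (summable_jacobiTheta₂_term_iff (t : ℂ) (Complex.I * a)).2 (by simpa using ha)
  refine h.norm.congr fun k => ?_
  unfold jacobiTheta₂_term
  congr 2
  linear_combination (π * a * k ^ 2) * Complex.I_sq

lemma summable_norm_exp_gaussian {a : ℝ} (ha : 0 < a) (t : ℝ) :
    Summable fun n : ℤ => ‖Complex.exp (-π / a * (n + t) ^ 2)‖ := by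
  have h := (summable_jacobiTheta₂_term_iff (Complex.I * t / a : ℂ) (Complex.I / a)).2 (by
    rw [Complex.div_ofReal_im, Complex.I_im]; positivity)
  refine (h.norm.mul_left ‖Complex.exp (-π / a * t ^ 2)‖).congr fun k => ?_
  unfold jacobiTheta₂_term
  rw [← norm_mul, ← Complex.exp_add]
  congr 2
  have : (a : ℂ) ≠ 0 := by exact_mod_cast ha.ne'
  field_simp
  linear_combination (2 * k * t + k ^ 2 : ℂ) * Complex.I_sq

lemma tsum_exp_gaussian {a : ℝ} (ha : 0 < a) (t : ℝ) :
    ∑' n : ℤ, Complex.exp (-π / a * (n + t) ^ 2) =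
      (√a : ℂ) * ∑' k : ℤ, Complex.exp (-π * a * k ^ 2 + 2 * π * (Complex.I * t) * k) := by
  have h := Complex.tsum_exp_neg_quadratic (a := a) (by simpa using ha) (Complex.I * t)
  have hs : (a : ℂ) ^ (1 / 2 : ℂ) = (√a : ℂ) := by
    rw [sqrt_eq_rpow, Complex.ofReal_cpow ha.le]; norm_num
  have h0 : (√a : ℂ) ≠ 0 := by exact_mod_cast (sqrt_pos.2 ha).ne'
  -- The parameter `I * t` produces the shift `I * (I * t) = -t`; replacing `n` by `-n` makes the
  -- square `(n + t)²`.
  rw [h, hs, ← mul_assoc, mul_one_div_cancel h0, one_mul, ← (Equiv.neg ℤ).tsum_eq]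
  congr 1; ext n
  congr 2
  simp only [Equiv.neg_apply]
  push_cast
  rw [← mul_assoc, Complex.I_mul_I]
  ring

/-- Poisson summation for the multivariate Gaussian. -/
lemma tsum_gaussian_euclidean {d : ℕ} {a : ℝ} (ha : 0 < a) (x : EuclideanSpace ℝ (Fin d)) :
    ∑' n : Fin d → ℤ, ((exp (-(π / a) * ‖x + latticePoint n‖ ^ 2) : ℝ) : ℂ) =
      ∑' k : Fin d → ℤ, ((a ^ (d / 2 : ℝ) * exp (-(π * a * ‖latticePoint k‖ ^ 2)) : ℝ) : ℂ) *
        Complex.exp (2 * π * Complex.I * (∑ i, (k i : ℝ) * x i : ℝ)) := by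
  have h1 := (hasSum_prod_fin fun i : Fin d => summable_norm_exp_gaussian ha (x i)).2.tsum_eq
  have h2 := (hasSum_prod_fin fun i : Fin d => summable_norm_exp_theta ha (x i)).2.tsum_eq
  simp only [tsum_exp_gaussian ha, Finset.prod_mul_distrib, ← h2] at h1
  rw [← tsum_mul_left] at h1
  convert! h1 using 3 with n n
  · rw [← Complex.exp_sum, Complex.ofReal_exp]
    congr 1
    rw [EuclideanSpace.norm_sq_eq, Finset.mul_sum]
    push_cast
    refine Finset.sum_congr rfl fun i _ => ?_
    simp only [PiLp.add_apply, latticePoint, norm_eq_abs, ← Complex.ofReal_pow, sq_abs]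
    push_cast
    ring
  · have e : ∏ _i : Fin d, (√a : ℂ) = ((a ^ (d / 2 : ℝ) : ℝ) : ℂ) := by
      rw [Finset.prod_const, Finset.card_univ, Fintype.card_fin, sqrt_eq_rpow, ← Complex.ofReal_pow,
        ← rpow_natCast, ← rpow_mul ha.le]
      congr 2; ring
    rw [e, Complex.ofReal_mul, mul_assoc, Complex.ofReal_exp, ← Complex.exp_add, ← Complex.exp_sum]
    congr 2
    rw [norm_latticePoint_sq]
    push_cast
    rw [Finset.mul_sum, Finset.mul_sum, ← Finset.sum_neg_distrib, ← Finset.sum_add_distrib]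
    refine Finset.sum_congr rfl fun i _ => ?_
    ring

lemma integrableOn_mixWeight_mul_gaussian {d : ℕ} {ν α : ℝ} (hν : 0 < ν) (hα : 0 < α)
    (x : EuclideanSpace ℝ (Fin d)) :
    IntegrableOn (fun s => mixWeight ν s * exp (-(4 * α ^ 2 * s)⁻¹ * ‖x‖ ^ 2)) (Ioi 0) := by
  have hm : Measurable fun s => mixWeight ν s * exp (-(4 * α ^ 2 * s)⁻¹ * ‖x‖ ^ 2) := by fun_prop
  refine Integrable.mono (integrableOn_mixWeight hν) hm.aestronglyMeasurable ?_
  filter_upwards [ae_restrict_mem measurableSet_Ioi] with s hs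
  have hs : 0 < s := hs
  rw [norm_mul, norm_of_nonneg (exp_pos _).le]
  refine mul_le_of_le_one_right (norm_nonneg _) (exp_le_one_iff.2 ?_)
  rw [neg_mul, neg_nonpos]
  positivity

/-- Poisson summation for the Whittle–Matérn covariance. -/
lemma covApp_eq_tsum {d : ℕ} (hd : 1 ≤ d) {ρ ν α : ℝ} (hν : 0 < ν) (hα : 0 < α) (hρ : 0 ≤ ρ)
    {x : EuclideanSpace ℝ (Fin d)} (hx : Summable fun n => cov d ρ ν α (x + latticePoint n)) :
    covApp d ρ ν α x = ((∑' n, cov d ρ ν α (x + latticePoint n) : ℝ) : ℂ) := by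
  have hG := Gamma_pos_of_pos hν
  let F : (Fin d → ℤ) → ℝ → ℂ := fun n s => ((ρ / Gamma ν * (mixWeight ν s *
    exp (-(4 * α ^ 2 * s)⁻¹ * ‖x + latticePoint n‖ ^ 2)) : ℝ) : ℂ)
  let H : (Fin d → ℤ) → ℝ → ℝ := fun k s => ρ / Gamma ν * (mixWeight ν s *
    ((4 * π * α ^ 2 * s) ^ (d / 2 : ℝ) * exp (-(4 * π ^ 2 * α ^ 2 * ‖latticePoint k‖ ^ 2 * s))))
  let e : (Fin d → ℤ) → ℂ := fun k => Complex.exp (2 * π * Complex.I * (∑ i, (k i : ℝ) * x i : ℝ))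
  have he : ∀ k, ‖e k‖ = 1 := fun k => by
    simp only [e]
    rw [show (2 * π * Complex.I * (∑ i, (k i : ℝ) * x i : ℝ) : ℂ) =
      ((2 * π * ∑ i, (k i : ℝ) * x i : ℝ) : ℂ) * Complex.I by push_cast; ring,
      Complex.norm_exp_ofReal_mul_I]
  have hHnn : ∀ k, ∀ s ∈ Ioi (0 : ℝ), 0 ≤ H k s := fun k s hs => by
    have h1 := mixWeight_nonneg ν hs
    have hs : 0 < s := hs
    simp only [H]
    positivity
  have hFnn : ∀ n, ∀ s ∈ Ioi (0 : ℝ), 0 ≤ ρ / Gamma ν * (mixWeight ν s *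
      exp (-(4 * α ^ 2 * s)⁻¹ * ‖x + latticePoint n‖ ^ 2)) := fun k s hs => by
    have h1 := mixWeight_nonneg ν hs
    positivity
  have hHint : ∀ k, IntegrableOn (H k) (Ioi 0) := fun k =>
    (integrableOn_mixWeight_mul_rpow (c := 4 * π * α ^ 2) (by positivity) (by positivity)
      (by positivity)).const_mul _
  have hHval : ∀ k, ((∫ s in Ioi (0 : ℝ), H k s : ℝ) : ℂ) =
      spectralDensity d ρ ν α (latticePoint k) := fun k => by
    rw [spectralDensity_eq_integral hν hα, integral_const_mul]
  have hFval : ∀ n, ∫ s in Ioi (0 : ℝ), F n s = (cov d ρ ν α (x + latticePoint n) : ℂ) := fun n => by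
    simp only [F]
    rw [integral_complex_ofReal, integral_const_mul, cov_eq_integral hν hα]
  -- All weights are nonnegative, so the integrals of the norms are the covariances themselves here,
  -- and the values of the spectral density in `hK`. Summability of these justifies both exchanges
  -- of sum and integral.
  have hF := hasSum_integral_of_summable_integral_norm (μ := volume.restrict (Ioi 0)) (F := F)
    (fun n => ((integrableOn_mixWeight_mul_gaussian hν hα _).const_mul _).ofReal) (by
      refine hx.congr fun n => ?_
      rw [cov_eq_integral hν hα, ← integral_const_mul]
      refine setIntegral_congr_fun measurableSet_Ioi fun s hs => ?_
      simp only [F]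
      rw [Complex.norm_real, norm_of_nonneg (hFnn n s hs)])
  have hK := hasSum_integral_of_summable_integral_norm (μ := volume.restrict (Ioi 0))
    (F := fun k s => (H k s : ℂ) * e k)
    (fun k => ((hHint k).ofReal).mul_const _) (by
      refine (summable_norm_spectralDensity hd hν hα (ρ := ρ)).congr fun k => ?_
      rw [← hHval, Complex.norm_real, norm_of_nonneg (setIntegral_nonneg measurableSet_Ioi (hHnn k))]
      refine setIntegral_congr_fun measurableSet_Ioi fun s hs => ?_
      rw [norm_mul, he, mul_one, Complex.norm_real, norm_of_nonneg (hHnn k s hs)])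
  have hKF : ∫ s in Ioi (0 : ℝ), ∑' k, (H k s : ℂ) * e k = ∫ s in Ioi (0 : ℝ), ∑' n, F n s := by
    refine setIntegral_congr_fun measurableSet_Ioi fun s hs => ?_
    have hs : 0 < s := hs
    -- With this `a`, `π / a` is the Gaussian rate `(4α²s)⁻¹`.
    have h := tsum_gaussian_euclidean (a := 4 * π * α ^ 2 * s) (by positivity) x
    have h' := congrArg (fun z => ((ρ / Gamma ν * mixWeight ν s : ℝ) : ℂ) * z) h
    simp only [← tsum_mul_left] at h'
    convert! h'.symm using 3 with k n
    · simp only [H, e]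
      rw [show π * (4 * π * α ^ 2 * s) * ‖latticePoint k‖ ^ 2 =
        4 * π ^ 2 * α ^ 2 * ‖latticePoint k‖ ^ 2 * s by ring]
      push_cast
      ring
    · simp only [F]
      rw [← Complex.ofReal_mul, mul_assoc (ρ / Gamma ν)]
      congr 5
      field_simp
  have hA : HasSum (appTerm d ρ ν α x) (∫ s in Ioi (0 : ℝ), ∑' k, (H k s : ℂ) * e k) := by
    refine hK.congr_fun fun k => ?_
    rw [integral_mul_const, integral_complex_ofReal, hHval]
    rfl
  unfold covApp
  rw [hA.tsum_eq, hKF, ← hF.tsum_eq, Complex.ofReal_tsum]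
  simp only [hFval]

/-! ### Alzer's incomplete Gamma inequality -/

/-- The function `y ↦ (1 - e^{-y})/y = ∫₀¹ e^{-yt} dt`. -/
def expMean (y : ℝ) : ℝ := (1 - exp (-y)) / y

lemma expMean_pos {y : ℝ} (hy : 0 < y) : 0 < expMean y :=
  div_pos (by simpa using hy) hy

lemma integral_exp_neg_mul_Ioc {y : ℝ} (hy : 0 < y) :
    ∫ t in Ioc (0 : ℝ) 1, exp (-(y * t)) = expMean y := by
  rw [← intervalIntegral.integral_of_le zero_le_one]
  have h := intervalIntegral.integral_comp_mul_left (a := 0) (b := 1) (fun t => exp t)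
    (neg_ne_zero.2 hy.ne')
  simp only [neg_mul, mul_zero, mul_one, integral_exp, smul_eq_mul, exp_zero] at h
  rw [h, expMean]
  field_simp
  ring

/-- Log-convexity of `expMean`, in the form of its star-shapedness at `0`. -/
lemma expMean_mul_le {y θ : ℝ} (hy : 0 < y) (h0 : 0 < θ) (h1 : θ ≤ 1) :
    expMean (θ * y) ≤ expMean y ^ θ := by
  have : IsProbabilityMeasure (volume.restrict (Ioc (0 : ℝ) 1)) := ⟨by simp⟩
  have hi : ∀ c : ℝ, Integrable (fun t => exp (-(c * t))) (volume.restrict (Ioc (0 : ℝ) 1)) :=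
    fun c => ((Continuous.integrableOn_Icc (by fun_prop)).mono_set Ioc_subset_Icc_self)
  have he : ∀ t : ℝ, exp (-(y * t)) ^ θ = exp (-(θ * y * t)) := fun t => by
    rw [← exp_mul]; congr 1; ring
  -- Jensen for the concave power `x ↦ x^θ` under the uniform law on `(0, 1]`.
  have h := (concaveOn_rpow h0.le h1).le_map_integral
    (continuousOn_id.rpow_const fun x _ => Or.inr h0.le) isClosed_Ici
    (ae_of_all (volume.restrict (Ioc (0 : ℝ) 1)) fun t => (exp_pos (-(y * t))).le) (hi y)
    (by simpa only [Function.comp_def, he] using hi (θ * y))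
  simp only [he] at h
  rwa [integral_exp_neg_mul_Ioc hy, integral_exp_neg_mul_Ioc (by positivity)] at h

section IncompleteGamma

variable {a b : ℝ}

lemma continuous_gammaIntegrand (ha : 1 ≤ a) :
    Continuous fun t : ℝ => t ^ (a - 1) * exp (-t) :=
  (continuous_id.rpow_const fun _ => Or.inr (by linarith)).mul (by fun_prop)

lemma integrableOn_gammaIntegrand (ha : 0 < a) :
    IntegrableOn (fun t : ℝ => t ^ (a - 1) * exp (-t)) (Ioi 0) := by
  simpa using integrableOn_rpow_mul_exp_neg_mul ha one_pos

lemma integral_gammaIntegrand (ha : 0 < a) :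
    ∫ t in Ioi (0 : ℝ), t ^ (a - 1) * exp (-t) = Gamma a := by
  simpa using integral_rpow_mul_exp_neg_mul_Ioi ha one_pos

/-- The ratio of the derivatives of the two sides of `gamma_mul_one_sub_exp_rpow_le`. -/
def derivRatio (a b r : ℝ) : ℝ := expMean (b * r) ^ (a - 1) * exp ((1 - b) * r)

/-- The ratio is log-convex in `r` with limit `1` at `0`, so its value at `s` is at most its value
at `r` to the power `s/r`. Hence it can cross `1` only once, upwards. -/
lemma derivRatio_le_one (ha : 1 ≤ a) (hb : 0 < b) {r s : ℝ} (hs : 0 < s) (hsr : s ≤ r)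
    (h : derivRatio a b r ≤ 1) : derivRatio a b s ≤ 1 := by
  have hr : 0 < r := hs.trans_le hsr
  have hθ : 0 < s / r := by positivity
  have hm := expMean_pos (mul_pos hb hr)
  have key : derivRatio a b s ≤ derivRatio a b r ^ (s / r) := by
    unfold derivRatio
    rw [mul_rpow (by positivity) (exp_pos _).le, ← exp_mul, ← rpow_mul hm.le, mul_comm (a - 1),
      rpow_mul hm.le, show (1 - b) * r * (s / r) = (1 - b) * s by field_simp]
    gcongr
    · exact (expMean_pos (mul_pos hb hs)).le
    · have := expMean_mul_le (mul_pos hb hr) hθ ((div_le_one hr).2 hsr)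
      rwa [show s / r * (b * r) = b * s by field_simp] at this
  exact key.trans (rpow_le_one (by unfold derivRatio; positivity) h hθ.le)

/-- The normalisation `hab` says `Γ(a) a b = b^{-(a-1)}`, exactly the constant that turns `1 -
e^{-br}` into `expMean (b * r)`. -/
lemma hasDerivAt_gammaGap (ha : 1 ≤ a) (hb : 0 < b) (hab : Gamma a * a * b ^ a = 1) {r : ℝ}
    (hr : 0 < r) :
    HasDerivAt (fun r => Gamma a * (1 - exp (-(b * r))) ^ a -
      ∫ t in (0 : ℝ)..r, t ^ (a - 1) * exp (-t))
      (r ^ (a - 1) * exp (-r) * (derivRatio a b r - 1)) r := by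
  have hc := continuous_gammaIntegrand ha
  have h1 : HasDerivAt (fun r => ∫ t in (0 : ℝ)..r, t ^ (a - 1) * exp (-t))
      (r ^ (a - 1) * exp (-r)) r :=
    intervalIntegral.integral_hasDerivAt_right (hc.intervalIntegrable _ _)
      hc.stronglyMeasurable.stronglyMeasurableAtFilter hc.continuousAt
  have h2 : HasDerivAt (fun r => 1 - exp (-(b * r))) (b * exp (-(b * r))) r := by
    have := (((hasDerivAt_id r).const_mul b).neg.exp).const_sub 1
    convert! this using 1
    simp; ring
  have h3 := ((h2.rpow_const (p := a) (Or.inr ha)).const_mul (Gamma a)).sub h1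
  convert! h3 using 1
  have hpos : 0 < 1 - exp (-(b * r)) := by
    have : 0 < b * r := by positivity
    simpa using this
  have e1 : derivRatio a b r * (r ^ (a - 1) * exp (-r)) =
      (1 - exp (-(b * r))) ^ (a - 1) * (b ^ (a - 1))⁻¹ * exp (-(b * r)) := by
    unfold derivRatio expMean
    rw [div_rpow hpos.le (by positivity), mul_rpow hb.le hr.le,
      show -(b * r) = (1 - b) * r + -r by ring, exp_add]
    field_simp
  have e2 : Gamma a * a * b = (b ^ (a - 1))⁻¹ := by
    rw [rpow_sub_one hb.ne']
    field_simp
    linarith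
  rw [mul_sub, mul_one, mul_comm _ (derivRatio a b r), e1, ← e2]
  ring

/-- Alzer's lower bound for the incomplete Gamma function. -/
lemma gamma_mul_one_sub_exp_rpow_le (ha : 1 ≤ a) (hb : 0 < b) (hab : Gamma a * a * b ^ a = 1)
    {r : ℝ} (hr : 0 < r) :
    Gamma a * (1 - exp (-(b * r))) ^ a ≤ ∫ t in (0 : ℝ)..r, t ^ (a - 1) * exp (-t) := by
  set h : ℝ → ℝ := fun r => Gamma a * (1 - exp (-(b * r))) ^ a -
      ∫ t in (0 : ℝ)..r, t ^ (a - 1) * exp (-t) with hh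
  have ha0 : 0 < a := by linarith
  have hd : ∀ s, 0 < s → HasDerivAt h (s ^ (a - 1) * exp (-s) * (derivRatio a b s - 1)) s :=
    fun s hs => hasDerivAt_gammaGap ha hb hab hs
  have hcont : Continuous h := by
    refine Continuous.sub (continuous_const.mul (Continuous.rpow_const (by fun_prop)
      fun _ => Or.inr ha0.le)) ?_
    exact intervalIntegral.continuous_primitive
      (fun _ _ => (continuous_gammaIntegrand ha).intervalIntegrable _ _) 0
  suffices h r ≤ 0 by simpa [hh] using this
  -- The gap `h` is `0` at the origin and tends to `0` at infinity. If the ratio is at most `1` at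
  -- `r`, then `h` decreases on `[0, r]`; otherwise it increases on `[r, ∞)` towards `0`.
  by_cases hR : derivRatio a b r ≤ 1
  · have hanti : AntitoneOn h (Icc 0 r) := by
      refine antitoneOn_of_deriv_nonpos (convex_Icc 0 r) hcont.continuousOn
        (fun s hs => ?_) fun s hs => ?_ <;> rw [interior_Icc] at hs
      · exact (hd s hs.1).differentiableAt.differentiableWithinAt
      · rw [(hd s hs.1).deriv]
        have := derivRatio_le_one ha hb hs.1 hs.2.le hR
        have h0 := hs.1
        exact mul_nonpos_of_nonneg_of_nonpos (by positivity) (by linarith)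
    have h0 : h 0 = 0 := by simp [hh, zero_rpow ha0.ne']
    rw [← h0]
    exact hanti ⟨le_rfl, hr.le⟩ ⟨hr.le, le_rfl⟩ hr.le
  · have hmono : MonotoneOn h (Ici r) := by
      refine monotoneOn_of_deriv_nonneg (convex_Ici r) hcont.continuousOn
        (fun s hs => ?_) fun s hs => ?_ <;> rw [interior_Ici] at hs
      · exact (hd s (hr.trans hs)).differentiableAt.differentiableWithinAt
      · have hs0 : 0 < s := hr.trans hs
        rw [(hd s hs0).deriv]
        have : ¬ derivRatio a b s ≤ 1 := fun h' => hR (derivRatio_le_one ha hb hr (le_of_lt hs) h')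
        exact mul_nonneg (by positivity) (by linarith)
    have hlim : Tendsto h atTop (𝓝 0) := by
      have h1 := intervalIntegral_tendsto_integral_Ioi 0 (integrableOn_gammaIntegrand ha0)
        tendsto_id
      rw [integral_gammaIntegrand ha0] at h1
      have h2 : Tendsto (fun r => exp (-(b * r))) atTop (𝓝 0) :=
        tendsto_exp_neg_atTop_nhds_zero.comp (tendsto_id.const_mul_atTop hb)
      have h3 := ((h2.const_sub 1).rpow_const (p := a) (Or.inr ha0.le)).const_mul (Gamma a)
      simpa using h3.sub h1
    refine ge_of_tendsto hlim ?_
    filter_upwards [eventually_ge_atTop r] with s hs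
    exact hmono self_mem_Ici hs hs

/-- Take the complement in Alzer's bound and apply Bernoulli, `(1 - q)^a ≥ 1 - aq`. -/
lemma upperGamma_le (ha : 1 ≤ a) (hb : 0 < b) (hab : Gamma a * a * b ^ a = 1)
    {r : ℝ} (hr : 0 < r) :
    ∫ t in Ioi r, t ^ (a - 1) * exp (-t) ≤ Gamma a * (a * exp (-(b * r))) := by
  have ha0 : 0 < a := by linarith
  have h1 := gamma_mul_one_sub_exp_rpow_le ha hb hab hr
  have hi := integrableOn_gammaIntegrand ha0
  have h2 : (∫ t in (0 : ℝ)..r, t ^ (a - 1) * exp (-t)) + ∫ t in Ioi r, t ^ (a - 1) * exp (-t) =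
      Gamma a := by
    rw [← integral_gammaIntegrand ha0]
    exact intervalIntegral.integral_interval_add_Ioi hi (hi.mono_set (Ioi_subset_Ioi hr.le))
  have h3 := one_add_mul_self_le_rpow_one_add (s := -exp (-(b * r))) (p := a)
    (by have : exp (-(b * r)) ≤ 1 := exp_le_one_iff.2 (by have := mul_pos hb hr; linarith)
        linarith) ha
  have hG := Gamma_pos_of_pos ha0
  have h4 := mul_le_mul_of_nonneg_left h3 hG.le
  rw [← sub_eq_add_neg] at h4
  linarith

end IncompleteGamma

/-! ### Exponential decay of the covariance -/

/-- The duplication formula merges the Gamma factors into `1/Γ(2ν)`. -/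
lemma cov_of_ne_zero {d : ℕ} {ρ ν α : ℝ} (hν : 0 < ν) (hα : 0 < α) {x : EuclideanSpace ℝ (Fin d)}
    (hx : x ≠ 0) :
    cov d ρ ν α x = ρ * ((‖x‖ / α) ^ (2 * ν) / Gamma (2 * ν) *
      ∫ t in Ioi (1 : ℝ), exp (-(‖x‖ / α * t)) * (t ^ 2 - 1) ^ (ν - 1 / 2)) := by
  have hr : 0 < ‖x‖ / α := div_pos (norm_pos_iff.2 hx) hα
  have hrx : ‖α⁻¹ • x‖ = ‖x‖ / α := by
    rw [norm_smul, norm_inv, norm_of_nonneg hα.le]; field_simp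
  unfold cov
  rw [if_neg hx, hrx]
  unfold besselK
  generalize ∫ t in Ioi (1 : ℝ), exp (-(‖x‖ / α * t)) * (t ^ 2 - 1) ^ (ν - 1 / 2) = J
  generalize ‖x‖ / α = r at *
  have hG := Gamma_pos_of_pos hν
  have hG1 := Gamma_pos_of_pos (show 0 < ν + 1 / 2 by linarith)
  have hG2 := Gamma_pos_of_pos (show 0 < 2 * ν by linarith)
  have hdup := Gamma_mul_Gamma_add_half ν
  have e1 : (r / 2) ^ ν = r ^ ν / 2 ^ ν := div_rpow hr.le zero_le_two _
  have e2 : r ^ (2 * ν) = r ^ ν * r ^ ν := by rw [two_mul, rpow_add hr]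
  have e3 : (2 : ℝ) ^ (1 - ν) = 2 ^ (1 - 2 * ν) * 2 ^ ν := by
    rw [← rpow_add two_pos]; congr 1; ring
  rw [e1, e2, e3]
  generalize Gamma (ν + 1 / 2) = G1 at *
  field_simp
  linear_combination (-(ρ * J)) * hdup

lemma integrableOn_sub_one_rpow_mul_exp {r p : ℝ} (hr : 0 < r) (hp : 0 < p) :
    IntegrableOn (fun t : ℝ => (t - 1) ^ (p - 1) * exp (-(r * (t - 1)))) (Ioi 1) ∧
    ∫ t in Ioi (1 : ℝ), (t - 1) ^ (p - 1) * exp (-(r * (t - 1))) = r ^ (-p) * Gamma p := by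
  have hmp := measurePreserving_sub_right (volume : Measure ℝ) 1
  have hme := (MeasurableEquiv.subRight (1 : ℝ)).measurableEmbedding
  have hpre : (fun t : ℝ => t - 1) ⁻¹' Ioi 0 = Ioi 1 := by ext; simp
  constructor
  · rw [← hpre]
    exact (hmp.integrableOn_comp_preimage hme).2 (integrableOn_rpow_mul_exp_neg_mul hp hr)
  · have := hmp.setIntegral_preimage_emb hme (fun u => u ^ (p - 1) * exp (-(r * u))) (Ioi 0)
    rw [hpre, integral_rpow_mul_exp_neg_mul_Ioi hp hr, one_div, inv_rpow hr.le,
      ← rpow_neg hr.le] at this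
    exact this

/-- Factor `t² - 1 = (t+1)(t-1)`; the exponent is nonpositive, so `t + 1` may be lowered to `2`,
leaving a shifted Gamma integral. -/
lemma integral_bessel_le_of_le_half {r ν : ℝ} (hr : 0 < r) (hν : 0 < ν) (hν2 : ν ≤ 1 / 2) :
    ∫ t in Ioi (1 : ℝ), exp (-(r * t)) * (t ^ 2 - 1) ^ (ν - 1 / 2) ≤
      2 ^ (ν - 1 / 2) * exp (-r) * (r ^ (-(ν + 1 / 2)) * Gamma (ν + 1 / 2)) := by
  obtain ⟨hi, hv⟩ := integrableOn_sub_one_rpow_mul_exp hr (p := ν + 1 / 2) (by linarith)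
  rw [← hv, ← integral_const_mul]
  refine integral_mono_of_nonneg ?_ (hi.const_mul _) ?_
  · filter_upwards [ae_restrict_mem measurableSet_Ioi] with t ht
    have ht : 1 < t := ht
    have : 0 < t ^ 2 - 1 := by nlinarith
    positivity
  · filter_upwards [ae_restrict_mem measurableSet_Ioi] with t ht
    have ht : 1 < t := ht
    have h1 : 0 < t - 1 := by linarith
    have e1 : (t ^ 2 - 1) ^ (ν - 1 / 2) = (t + 1) ^ (ν - 1 / 2) * (t - 1) ^ (ν - 1 / 2) := by
      rw [← mul_rpow (by linarith) h1.le]; congr 1; ring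
    have e2 : (t + 1) ^ (ν - 1 / 2) ≤ 2 ^ (ν - 1 / 2) :=
      rpow_le_rpow_of_nonpos two_pos (by linarith) (by linarith)
    have e3 : exp (-(r * t)) = exp (-r) * exp (-(r * (t - 1))) := by
      rw [← exp_add]; congr 1; ring
    rw [e1, e3, show ν + 1 / 2 - 1 = ν - 1 / 2 by ring]
    calc _ = (t + 1) ^ (ν - 1 / 2) * (exp (-r) * ((t - 1) ^ (ν - 1 / 2) * exp (-(r * (t - 1))))) := by
          ring
      _ ≤ 2 ^ (ν - 1 / 2) * (exp (-r) * ((t - 1) ^ (ν - 1 / 2) * exp (-(r * (t - 1))))) := by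
          gcongr
      _ = _ := by ring

lemma cov_le_of_le_half {d : ℕ} {ρ ν α : ℝ} (hν : 0 < ν) (hν2 : ν ≤ 1 / 2) (hα : 0 < α)
    (hρ : 0 ≤ ρ) {x : EuclideanSpace ℝ (Fin d)} (hx : 1 / 2 ≤ ‖x‖) :
    cov d ρ ν α x ≤ (4 * α) ^ (1 / 2 - ν) * ρ * √π / Gamma ν * exp (-(‖x‖ / α)) := by
  have hx0 : x ≠ 0 := by rintro rfl; norm_num at hx
  have hxp : 0 < ‖x‖ := by linarith
  rw [cov_of_ne_zero hν hα hx0]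
  have hr : 0 < ‖x‖ / α := by positivity
  have hlow : (2 * α)⁻¹ ≤ ‖x‖ / α := by
    rw [le_div_iff₀ hα]; field_simp; linarith
  have hJ := integral_bessel_le_of_le_half hr hν hν2
  generalize ∫ t in Ioi (1 : ℝ), exp (-(‖x‖ / α * t)) * (t ^ 2 - 1) ^ (ν - 1 / 2) = J at *
  generalize ‖x‖ / α = r at *
  have hG := Gamma_pos_of_pos hν
  have hG1 := Gamma_pos_of_pos (show 0 < ν + 1 / 2 by linarith)
  have hG2 := Gamma_pos_of_pos (show 0 < 2 * ν by linarith)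
  have hdup := Gamma_mul_Gamma_add_half ν
  -- Here `‖x‖ ≥ 1/2` enters: it controls the negative power of `r` that is singular at the origin.
  have e0 : r ^ (ν - 1 / 2) ≤ (2 * α) ^ (1 / 2 - ν) := by
    have := rpow_le_rpow_of_nonpos (by positivity) hlow (show ν - 1 / 2 ≤ 0 by linarith)
    rwa [inv_rpow (by positivity), ← rpow_neg (by positivity), neg_sub] at this
  have e1 : (4 * α) ^ (1 / 2 - ν) = 2 ^ (1 / 2 - ν) * (2 * α) ^ (1 / 2 - ν) := by
    rw [← mul_rpow zero_le_two (by positivity)]; congr 1; ring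
  have e2 : r ^ (2 * ν) * r ^ (-(ν + 1 / 2)) = r ^ (ν - 1 / 2) := by
    rw [← rpow_add hr]; congr 1; ring
  have e3 : (2 : ℝ) ^ (ν - 1 / 2) * 2 ^ (1 - 2 * ν) = 2 ^ (1 / 2 - ν) := by
    rw [← rpow_add two_pos]; congr 1; ring
  have e4 : Gamma (ν + 1 / 2) / Gamma (2 * ν) = 2 ^ (1 - 2 * ν) * √π / Gamma ν := by
    generalize Gamma (ν + 1 / 2) = G1 at *
    field_simp
    linear_combination hdup
  calc ρ * (r ^ (2 * ν) / Gamma (2 * ν) * J)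
      ≤ ρ * (r ^ (2 * ν) / Gamma (2 * ν) *
        (2 ^ (ν - 1 / 2) * exp (-r) * (r ^ (-(ν + 1 / 2)) * Gamma (ν + 1 / 2)))) := by gcongr
    _ = ρ * (2 ^ (ν - 1 / 2) * exp (-r) * (r ^ (2 * ν) * r ^ (-(ν + 1 / 2))) *
        (Gamma (ν + 1 / 2) / Gamma (2 * ν))) := by ring
    _ = ρ * √π / Gamma ν * exp (-r) * (2 ^ (ν - 1 / 2) * 2 ^ (1 - 2 * ν)) * r ^ (ν - 1 / 2) := by
      rw [e2, e4]; ring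
    _ ≤ ρ * √π / Gamma ν * exp (-r) * 2 ^ (1 / 2 - ν) * (2 * α) ^ (1 / 2 - ν) := by
      rw [e3]; gcongr
    _ = _ := by rw [e1]; ring

/-- The exponent is now nonnegative, so `t² - 1` may be raised to `t²`; rescaling by `r` gives an
upper incomplete Gamma integral. -/
lemma integral_bessel_le_of_half_le {r ν : ℝ} (hr : 0 < r) (hν2 : 1 / 2 ≤ ν) :
    r ^ (2 * ν) * ∫ t in Ioi (1 : ℝ), exp (-(r * t)) * (t ^ 2 - 1) ^ (ν - 1 / 2) ≤
      ∫ t in Ioi r, t ^ (2 * ν - 1) * exp (-t) := by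
  have hi := (integrableOn_rpow_mul_exp_neg_mul (show 0 < 2 * ν by linarith) hr).mono_set
    (Ioi_subset_Ioi zero_le_one)
  have h := integral_comp_mul_left_Ioi (fun t => t ^ (2 * ν - 1) * exp (-t)) 1 hr
  rw [mul_one, smul_eq_mul, eq_inv_mul_iff_mul_eq₀ hr.ne'] at h
  rw [← h, ← integral_const_mul, ← integral_const_mul]
  have hi' : IntegrableOn (fun t => r * ((r * t) ^ (2 * ν - 1) * exp (-(r * t)))) (Ioi 1) := by
    refine (hi.const_mul (r * r ^ (2 * ν - 1))).congr ?_
    filter_upwards [ae_restrict_mem measurableSet_Ioi] with t ht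
    have ht : 1 < t := ht
    rw [mul_rpow hr.le (by linarith)]; ring
  refine integral_mono_of_nonneg ?_ hi' ?_
  · filter_upwards [ae_restrict_mem measurableSet_Ioi] with t ht
    have ht : 1 < t := ht
    have : 0 < t ^ 2 - 1 := by nlinarith
    positivity
  · filter_upwards [ae_restrict_mem measurableSet_Ioi] with t ht
    have ht : 1 < t := ht
    have h0 : 0 < t ^ 2 - 1 := by nlinarith
    have e1 : (t ^ 2 - 1) ^ (ν - 1 / 2) ≤ t ^ (2 * ν - 1) := by
      rw [show 2 * ν - 1 = 2 * (ν - 1 / 2) by ring, rpow_mul (by linarith), rpow_two]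
      exact rpow_le_rpow h0.le (by linarith) (by linarith)
    have e2 : r * (r * t) ^ (2 * ν - 1) = r ^ (2 * ν) * t ^ (2 * ν - 1) := by
      rw [mul_rpow hr.le (by linarith), rpow_sub_one hr.ne']; field_simp
    calc _ ≤ r ^ (2 * ν) * (exp (-(r * t)) * t ^ (2 * ν - 1)) := by gcongr
      _ = _ := by rw [← mul_assoc r, e2]; ring

/-- Apply `upperGamma_le` with `a = 2ν`: its normalisation reads `Γ(1+2ν) b^{2ν} = 1`, which is the
origin of the Gamma power in `beta`. -/
lemma cov_le_of_half_le {d : ℕ} {ρ ν α : ℝ} (hν2 : 1 / 2 ≤ ν) (hα : 0 < α)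
    (hρ : 0 ≤ ρ) {x : EuclideanSpace ℝ (Fin d)} (hx : x ≠ 0) :
    cov d ρ ν α x ≤
      2 * ν * ρ * exp (-((Gamma (1 + 2 * ν) ^ (1 / (2 * ν)))⁻¹ * (‖x‖ / α))) := by
  have hν : 0 < ν := by linarith
  rw [cov_of_ne_zero hν hα hx]
  have hr : 0 < ‖x‖ / α := div_pos (norm_pos_iff.2 hx) hα
  have hG1 := Gamma_pos_of_pos (show 0 < 1 + 2 * ν by linarith)
  have hG2 := Gamma_pos_of_pos (show 0 < 2 * ν by linarith)
  have hJ := integral_bessel_le_of_half_le hr hν2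
  have hU := upperGamma_le (a := 2 * ν) (b := (Gamma (1 + 2 * ν) ^ (1 / (2 * ν)))⁻¹)
    (by linarith) (by positivity) (by
      rw [inv_rpow (by positivity), ← rpow_mul hG1.le, one_div_mul_cancel (by positivity), rpow_one,
        add_comm, Gamma_add_one (by positivity)]
      field_simp) hr
  have h := hJ.trans hU
  generalize ∫ t in Ioi (1 : ℝ), exp (-(‖x‖ / α * t)) * (t ^ 2 - 1) ^ (ν - 1 / 2) = J at *
  calc _ = ρ / Gamma (2 * ν) * ((‖x‖ / α) ^ (2 * ν) * J) := by ring
    _ ≤ ρ / Gamma (2 * ν) * _ := mul_le_mul_of_nonneg_left h (by positivity)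
    _ = _ := by field_simp

lemma cov_nonneg {d : ℕ} {ρ ν α : ℝ} (hν : 0 < ν) (hα : 0 < α) (hρ : 0 ≤ ρ)
    (x : EuclideanSpace ℝ (Fin d)) : 0 ≤ cov d ρ ν α x := by
  rw [cov_eq_integral hν hα]
  have hG := Gamma_pos_of_pos hν
  have := setIntegral_nonneg measurableSet_Ioi (μ := volume)
    (f := fun s => mixWeight ν s * exp (-(4 * α ^ 2 * s)⁻¹ * ‖x‖ ^ 2))
    fun s hs => mul_nonneg (mixWeight_nonneg ν hs) (exp_pos _).le
  positivity

/-- Passing to the `ℓ¹` norm, whose exponential factors over coordinates, costs the `√d` in `beta`.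
-/
lemma sum_abs_le_sqrt_mul_norm {d : ℕ} (x : EuclideanSpace ℝ (Fin d)) :
    ∑ i, |x i| ≤ √d * ‖x‖ := by
  rw [EuclideanSpace.norm_eq, ← sqrt_mul (Nat.cast_nonneg d)]
  refine le_sqrt_of_sq_le ?_
  have := sq_sum_le_card_mul_sum_sq (s := Finset.univ) (f := fun i => |x i|)
  simpa using this

lemma beta_pos {d : ℕ} (hd : 1 ≤ d) {ν α : ℝ} (hα : 0 < α) : 0 < beta d ν α := by
  unfold beta
  have : (0 : ℝ) < d := by exact_mod_cast hd
  have : 0 < max (Gamma (1 + 2 * ν) ^ (1 / (2 * ν))) 1 := lt_max_of_lt_right one_pos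
  positivity

/-- The exponential bound on the covariance away from the origin. -/
lemma cov_le_exp {d : ℕ} (hd : 1 ≤ d) {ρ ν α : ℝ} (hν : 0 < ν) (hα : 0 < α) (hρ : 0 ≤ ρ)
    {x : EuclideanSpace ℝ (Fin d)} (hx : 1 / 2 ≤ ‖x‖) :
    cov d ρ ν α x ≤ √(errorConst d ρ ν α / d) * exp (-(beta d ν α * ∑ i, |x i|)) := by
  have hd' : (0 : ℝ) < d := by exact_mod_cast hd
  have hG := Gamma_pos_of_pos hν
  have hM : 0 < max (Gamma (1 + 2 * ν) ^ (1 / (2 * ν))) 1 := lt_max_of_lt_right one_pos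
  have hx0 : x ≠ 0 := by rintro rfl; norm_num at hx
  have hxp : 0 < ‖x‖ := by linarith
  -- The two regimes decay at rate `c⁻¹` with `c` one of the two entries of the maximum.
  have hbeta : ∀ c, 0 < c → c ≤ max (Gamma (1 + 2 * ν) ^ (1 / (2 * ν))) 1 →
      exp (-(c⁻¹ * (‖x‖ / α))) ≤ exp (-(beta d ν α * ∑ i, |x i|)) := fun c hc hcM => by
    rw [exp_le_exp, neg_le_neg_iff]
    calc _ ≤ beta d ν α * (√d * ‖x‖) := by
          have := beta_pos hd hα (ν := ν)
          gcongr
          exact sum_abs_le_sqrt_mul_norm x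
      _ = (max (Gamma (1 + 2 * ν) ^ (1 / (2 * ν))) 1)⁻¹ * (‖x‖ / α) := by
          unfold beta; field_simp
      _ ≤ _ := by gcongr
  by_cases h : ν ≤ 1 / 2
  · have hc : √(errorConst d ρ ν α / d) = (4 * α) ^ (1 / 2 - ν) * ρ * √π / Gamma ν := by
      rw [sqrt_eq_iff_mul_self_eq (by unfold errorConst; rw [if_pos h]; positivity) (by positivity)]
      unfold errorConst
      rw [if_pos h, show 1 - 2 * ν = (1 / 2 - ν) + (1 / 2 - ν) by ring, rpow_add (by positivity)]
      field_simp
      rw [sq_sqrt pi_pos.le]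
    rw [hc]
    refine (cov_le_of_le_half hν h hα hρ hx).trans ?_
    have := hbeta 1 one_pos (le_max_right _ _)
    rw [inv_one, one_mul] at this
    gcongr
  · have hc : √(errorConst d ρ ν α / d) = 2 * ν * ρ := by
      rw [sqrt_eq_iff_mul_self_eq (by unfold errorConst; rw [if_neg h]; positivity) (by positivity)]
      unfold errorConst
      rw [if_neg h]
      field_simp
      ring
    rw [hc]
    refine (cov_le_of_half_le (le_of_not_ge h) hα hρ hx0).trans ?_
    have hG1 := Gamma_pos_of_pos (show 0 < 1 + 2 * ν by linarith)
    have := hbeta _ (by positivity) (le_max_left _ _)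
    gcongr

/-! ### Inequalities between the masses -/

/-- This is `tanh(b/2) ≤ b/2`. -/
lemma two_mul_one_sub_exp_neg_le {b : ℝ} (hb : 0 ≤ b) :
    2 * (1 - exp (-b)) ≤ b * (1 + exp (-b)) := by
  have hd : ∀ x : ℝ, HasDerivAt (fun x : ℝ => x * (1 + exp (-x)) - 2 * (1 - exp (-x)))
      (1 - exp (-x) * (x + 1)) x := fun x => by
    have h1 := (hasDerivAt_neg x).exp
    have := ((hasDerivAt_id x).mul (h1.const_add 1)).sub ((h1.const_sub 1).const_mul 2)
    convert! this using 1
    simp only [id]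
    ring
  have hmono : MonotoneOn (fun x : ℝ => x * (1 + exp (-x)) - 2 * (1 - exp (-x))) (Ici 0) := by
    refine monotoneOn_of_deriv_nonneg (convex_Ici 0)
      (fun x _ => (hd x).continuousAt.continuousWithinAt)
      (fun x _ => (hd x).differentiableAt.differentiableWithinAt) fun x _ => ?_
    rw [(hd x).deriv, sub_nonneg, exp_neg, inv_mul_le_one₀ (exp_pos x)]
    exact add_one_le_exp x
  have := hmono self_mem_Ici hb hb
  simp only [neg_zero, exp_zero] at this
  linarith

/-- `∫ S²` over the unit interval, where `S(x) = ∑ₙ e^{-b|x+n|}`. -/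
def sqMass (b : ℝ) : ℝ :=
  1 / b + 2 * exp (-b) / (1 - exp (-b)) * (1 / b + 1 / (1 - exp (-b)))

/-- `∫ S(x) e^{-b|x|} dx` over the unit interval. -/
def crossMass (b : ℝ) : ℝ := 1 / b + exp (-b) / (1 - exp (-b))

/-- The first factor of `epsMulti`. -/
def epsHead (b : ℝ) : ℝ := exp (-b) * (1 / b + 2 / (1 - exp (-b)) ^ 2 - 1 / 2)

lemma exp_neg_mem_Ioo {b : ℝ} (hb : 0 < b) : exp (-b) ∈ Ioo (0 : ℝ) 1 :=
  ⟨exp_pos _, by simpa using hb⟩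

lemma crossMass_le_sqMass {b : ℝ} (hb : 0 < b) : crossMass b ≤ sqMass b := by
  obtain ⟨h0, h1⟩ := exp_neg_mem_Ioo hb
  unfold crossMass sqMass
  generalize exp (-b) = q at *
  have hq : 0 < 1 - q := by linarith
  have h2 : 1 ≤ 1 / (1 - q) := by rw [le_div_iff₀ hq]; linarith
  have h3 : 0 < q / (1 - q) := by positivity
  have h4 : 0 < 1 / b := by positivity
  have : q / (1 - q) * 1 ≤ q / (1 - q) * (2 * (1 / b + 1 / (1 - q))) := by gcongr; linarith
  have e : 2 * q / (1 - q) * (1 / b + 1 / (1 - q)) = q / (1 - q) * (2 * (1 / b + 1 / (1 - q))) := by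
    ring
  rw [e]; linarith

lemma crossMass_pos {b : ℝ} (hb : 0 < b) : 0 < crossMass b := by
  obtain ⟨h0, h1⟩ := exp_neg_mem_Ioo hb
  unfold crossMass
  have hq : 0 < 1 - exp (-b) := by linarith
  positivity

/-- Here already `B - E ≤ A`, because `A - (B - E)` has the sign of `1/2 - 1/b`; multiply by `B + E
≤ 2B`. -/
lemma sq_sub_sq_le_of_two_le {b : ℝ} (hb : 2 ≤ b) :
    sqMass b ^ 2 - crossMass b ^ 2 ≤ 2 * epsHead b * sqMass b := by
  have hb0 : 0 < b := by linarith
  have hle := crossMass_le_sqMass hb0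
  have hpos := crossMass_pos hb0
  have key : sqMass b - crossMass b ≤ epsHead b := by
    obtain ⟨h0, h1⟩ := exp_neg_mem_Ioo hb0
    unfold crossMass sqMass epsHead
    generalize exp (-b) = q at *
    have hq : 0 < 1 - q := by linarith
    have hp : 1 / b ≤ 1 / 2 := one_div_le_one_div_of_le two_pos hb
    generalize 1 / b = p at *
    have e : q * (p + 2 / (1 - q) ^ 2 - 1 / 2) - (p + 2 * q / (1 - q) * (p + 1 / (1 - q)) -
        (p + q / (1 - q))) = q * (1 + q) / (1 - q) * (1 / 2 - p) := by
      field_simp; ring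
    have : 0 ≤ q * (1 + q) / (1 - q) * (1 / 2 - p) := mul_nonneg (by positivity) (by linarith)
    linarith
  nlinarith

/-- In `c = coth(b/2)` and `p = 1/b` the masses become polynomials, apart from a nonnegative term
`q(p - 1/2)` in `A`. What remains is polynomial on the range `1/2 ≤ p ≤ c/2`, `c > 1`. -/
lemma sq_sub_sq_le_of_le_two {b : ℝ} (hb0 : 0 < b) (hb : b ≤ 2) :
    sqMass b ^ 2 - crossMass b ^ 2 ≤ 2 * epsHead b * sqMass b := by
  have hB := (crossMass_pos hb0).trans_le (crossMass_le_sqMass hb0)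
  obtain ⟨h0, h1⟩ := exp_neg_mem_Ioo hb0
  have ht := two_mul_one_sub_exp_neg_le hb0.le
  unfold crossMass sqMass epsHead at *
  generalize exp (-b) = q at *
  have hq : 0 < 1 - q := by linarith
  have hp : 1 / 2 ≤ 1 / b := one_div_le_one_div_of_le hb0 hb
  have hpc : 1 / b ≤ (1 + q) / (1 - q) / 2 := by
    rw [div_div, div_le_div_iff₀ hb0 (by positivity)]; linarith
  generalize 1 / b = p at *
  obtain ⟨c, hc⟩ : ∃ c, c = (1 + q) / (1 - q) := ⟨_, rfl⟩
  have hc1 : 1 < c := by rw [hc, lt_div_iff₀ hq]; linarith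
  rw [← hc] at hpc
  have eB : p + 2 * q / (1 - q) * (p + 1 / (1 - q)) = c * p + (c ^ 2 - 1) / 2 := by
    rw [hc]; field_simp; ring
  have eE : p + q / (1 - q) = p + (c - 1) / 2 := by rw [hc]; field_simp; ring
  have eA : q * (p + 2 / (1 - q) ^ 2 - 1 / 2) = q * (p - 1 / 2) + (c ^ 2 - 1) / 2 := by
    rw [hc]; field_simp; ring
  rw [eB] at hB
  rw [eB, eE, eA]
  have h2 : 0 ≤ 2 * (q * (p - 1 / 2)) * (c * p + (c ^ 2 - 1) / 2) := by
    have : 0 ≤ q * (p - 1 / 2) := mul_nonneg h0.le (by linarith)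
    positivity
  have h3 : 0 ≤ (c / 2 - p) * ((c + 1) * (c / 2 + p) - 1) :=
    mul_nonneg (by linarith) (by nlinarith)
  have h4 : 0 ≤ (c - 1) * ((c - 1) / 2 + (c / 2 - p) * ((c + 1) * (c / 2 + p) - 1)) :=
    mul_nonneg (by linarith) (by linarith)
  linear_combination h2 + h4

/-- Induction from `d = 2` by `B^{d+1} - E^{d+1} = B(B^d - E^d) + E^d(B - E)`. The last term is
handled by `E(B-E) ≤ AB`, which follows from the case `d = 2` since `2E(B-E) = B² - E² - (B-E)²`. -/
lemma sqMass_pow_sub_crossMass_pow_le {b : ℝ} (hb : 0 < b) {d : ℕ} (hd : 2 ≤ d) :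
    sqMass b ^ d - crossMass b ^ d ≤ d * (epsHead b * sqMass b ^ (d - 1)) := by
  have h2 : sqMass b ^ 2 - crossMass b ^ 2 ≤ 2 * epsHead b * sqMass b :=
    (le_total b 2).elim (sq_sub_sq_le_of_le_two hb) sq_sub_sq_le_of_two_le
  have hE := crossMass_pos hb
  have hEB := crossMass_le_sqMass hb
  generalize sqMass b = B at *
  generalize crossMass b = E at *
  generalize epsHead b = A at *
  induction d, hd using Nat.le_induction with
  | base => norm_num; linarith
  | succ d hd ih =>
    obtain ⟨m, rfl⟩ : ∃ m, d = m + 1 := ⟨d - 1, by omega⟩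
    simp only [Nat.add_sub_cancel] at ih ⊢
    have hB : 0 < B := hE.trans_le hEB
    have h3 : E ^ (m + 1) * (B - E) ≤ B ^ m * (A * B) := by
      calc E ^ (m + 1) * (B - E) = E ^ m * (E * (B - E)) := by ring
        _ ≤ B ^ m * (E * (B - E)) := by
          have : 0 ≤ E * (B - E) := mul_nonneg hE.le (by linarith)
          gcongr
        _ ≤ B ^ m * (A * B) := by
          have : E * (B - E) ≤ A * B := by nlinarith [sq_nonneg (B - E)]
          gcongr
    have h4 := mul_le_mul_of_nonneg_left ih hB.le
    push_cast at h4 ⊢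
    calc B ^ (m + 1 + 1) - E ^ (m + 1 + 1)
        = B * (B ^ (m + 1) - E ^ (m + 1)) + E ^ (m + 1) * (B - E) := by ring
      _ ≤ B * (((m : ℝ) + 1) * (A * B ^ m)) + B ^ m * (A * B) := add_le_add h4 h3
      _ = _ := by ring

/-! ### The periodised exponential on the unit interval -/

/-- The nearest term `e^{-b|x|}` of the periodised exponential. -/
def expNear (b x : ℝ) : ℝ := exp (-(b * |x|))

/-- The remaining terms `∑_{n ≠ 0} e^{-b|x+n|}` of the periodised exponential, for `|x| ≤ 1/2`. -/
def expTail (b x : ℝ) : ℝ :=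
  (exp (b * |x|) + exp (-(b * |x|))) * (exp (-b) / (1 - exp (-b)))

lemma expNear_nonneg (b x : ℝ) : 0 ≤ expNear b x := (exp_pos _).le

lemma expTail_nonneg {b : ℝ} (hb : 0 < b) (x : ℝ) : 0 ≤ expTail b x := by
  obtain ⟨h0, h1⟩ := exp_neg_mem_Ioo hb
  have hq : 0 < 1 - exp (-b) := by linarith
  unfold expTail
  positivity

@[fun_prop]
lemma continuous_expNear (b : ℝ) : Continuous (expNear b) := by unfold expNear; fun_prop

@[fun_prop]
lemma continuous_expTail (b : ℝ) : Continuous (expTail b) := by unfold expTail; fun_prop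

/-- For `|x| ≤ 1/2` the sign of `x + n` is that of `n ≠ 0`, so each side is a geometric series. -/
lemma hasSum_exp_neg_abs_add {b x : ℝ} (hb : 0 < b) (hx : x ∈ Icc (-(1 / 2) : ℝ) (1 / 2)) :
    HasSum (fun n : ℤ => exp (-(b * |x + n|))) (expNear b x + expTail b x) := by
  obtain ⟨h0, h1⟩ := exp_neg_mem_Ioo hb
  have hg := hasSum_geometric_of_lt_one h0.le h1
  have hp : HasSum (fun n : ℕ => exp (-(b * |x + ((n + 1 : ℤ) : ℝ)|)))
      (exp (-(b * x)) * exp (-b) * (1 - exp (-b))⁻¹) := by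
    refine (hg.mul_left (exp (-(b * x)) * exp (-b))).congr_fun fun n => ?_
    have : 0 ≤ x + ((n + 1 : ℤ) : ℝ) := by push_cast; linarith [hx.1, Nat.cast_nonneg (α := ℝ) n]
    rw [abs_of_nonneg this, ← exp_nat_mul, ← exp_add, ← exp_add]
    push_cast; congr 1; ring
  have hm : HasSum (fun n : ℕ => exp (-(b * |x + ((-(n + 1 : ℤ) : ℤ) : ℝ)|)))
      (exp (b * x) * exp (-b) * (1 - exp (-b))⁻¹) := by
    refine (hg.mul_left (exp (b * x) * exp (-b))).congr_fun fun n => ?_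
    have : x + ((-(n + 1 : ℤ) : ℤ) : ℝ) ≤ 0 := by
      push_cast; linarith [hx.2, Nat.cast_nonneg (α := ℝ) n]
    rw [abs_of_nonpos this, ← exp_nat_mul, ← exp_add, ← exp_add]
    push_cast; congr 1; ring
  have h := HasSum.of_add_one_of_neg_add_one (f := fun n : ℤ => exp (-(b * |x + n|))) hp hm
  convert! h using 1
  have hsym : exp (b * |x|) + exp (-(b * |x|)) = exp (b * x) + exp (-(b * x)) := by
    rcases abs_choice x with hx | hx <;> rw [hx]
    simp only [mul_neg, neg_neg]; ring
  unfold expNear expTail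
  rw [hsym]
  simp only [Int.cast_zero, add_zero]
  ring

lemma integral_abs_half {f : ℝ → ℝ} (hf : Continuous f) :
    ∫ x in Icc (-(1 / 2) : ℝ) (1 / 2), f |x| = 2 * ∫ x in (0 : ℝ)..(1 / 2), f x := by
  have hc : Continuous fun x => f |x| := hf.comp continuous_abs
  rw [integral_Icc_eq_integral_Ioc, ← intervalIntegral.integral_of_le (by norm_num),
    ← intervalIntegral.integral_add_adjacent_intervals (b := 0) (hc.intervalIntegrable _ _)
      (hc.intervalIntegrable _ _)]
  have h1 : ∫ x in (0 : ℝ)..(1 / 2), f |x| = ∫ x in (0 : ℝ)..(1 / 2), f x :=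
    intervalIntegral.integral_congr fun x hx => by
      rw [uIcc_of_le (by norm_num)] at hx
      simp only [abs_of_nonneg hx.1]
  have h2 := intervalIntegral.integral_comp_neg (a := 0) (b := 1 / 2) (fun x => f |x|)
  simp only [abs_neg, neg_zero] at h2
  rw [← h2, h1]; ring

/-- Products of two of `expNear` and `expTail` are combinations of `e^{-2b|x|}`, `1` and
`e^{2b|x|}`, so this evaluates all three integrals below. -/
lemma integral_exp_combination {b : ℝ} (hb : 0 < b) (A C D : ℝ) :
    ∫ x in Icc (-(1 / 2) : ℝ) (1 / 2),
        (A * exp (-(b * |x|)) ^ 2 + C + D * exp (b * |x|) ^ 2) =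
      A * (1 - exp (-b)) / b + C + D * ((exp (-b))⁻¹ - 1) / b := by
  rw [integral_abs_half (f := fun x => A * exp (-(b * x)) ^ 2 + C + D * exp (b * x) ^ 2)
    (by fun_prop)]
  have hd : ∀ x : ℝ, HasDerivAt (fun x : ℝ => -(A / (2 * b)) * exp (-(b * x)) ^ 2 + C * x +
      D / (2 * b) * exp (b * x) ^ 2) (A * exp (-(b * x)) ^ 2 + C + D * exp (b * x) ^ 2) x :=
    fun x => by
      have h1 := ((hasDerivAt_id x).const_mul b).neg.exp.pow 2
      have h2 := ((hasDerivAt_id x).const_mul b).exp.pow 2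
      have := ((h1.const_mul (-(A / (2 * b)))).add ((hasDerivAt_id x).const_mul C)).add
        (h2.const_mul (D / (2 * b)))
      convert! this using 1
      simp
      field_simp
  rw [intervalIntegral.integral_eq_sub_of_hasDerivAt (fun x _ => hd x)
    (Continuous.intervalIntegrable (by fun_prop) _ _)]
  have e1 : exp (-(b * (1 / 2))) ^ 2 = exp (-b) := by rw [← exp_nat_mul]; congr 1; push_cast; ring
  have e2 : exp (b * (1 / 2)) ^ 2 = (exp (-b))⁻¹ := by
    rw [← exp_nat_mul, exp_neg, inv_inv]; congr 1; push_cast; ring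
  rw [e1, e2]
  simp
  field_simp
  ring

lemma exp_mul_exp_neg (t : ℝ) : exp t * exp (-t) = 1 := by rw [← exp_add]; simp

lemma integral_sq_periodised {b : ℝ} (hb : 0 < b) :
    ∫ x in Icc (-(1 / 2) : ℝ) (1 / 2), (expNear b x + expTail b x) ^ 2 = sqMass b := by
  obtain ⟨h0, h1⟩ := exp_neg_mem_Ioo hb
  set q := exp (-b) with hqd
  have hq : 0 < 1 - q := by linarith
  have h := integral_exp_combination hb ((1 + q / (1 - q)) ^ 2) (2 * (q / (1 - q)) * (1 + q / (1 - q)))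
    ((q / (1 - q)) ^ 2)
  rw [← hqd] at h
  unfold sqMass
  rw [← hqd]
  trans (1 + q / (1 - q)) ^ 2 * (1 - q) / b + 2 * (q / (1 - q)) * (1 + q / (1 - q)) +
    (q / (1 - q)) ^ 2 * (q⁻¹ - 1) / b
  · rw [← h]
    congr 1; ext x
    unfold expNear expTail
    rw [← hqd]
    linear_combination (2 * (q / (1 - q)) * (1 + q / (1 - q))) * exp_mul_exp_neg (b * |x|)
  · field_simp
    ring

lemma integral_periodised_mul_near {b : ℝ} (hb : 0 < b) :
    ∫ x in Icc (-(1 / 2) : ℝ) (1 / 2), (expNear b x + expTail b x) * expNear b x = crossMass b := by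
  obtain ⟨h0, h1⟩ := exp_neg_mem_Ioo hb
  set q := exp (-b) with hqd
  have hq : 0 < 1 - q := by linarith
  have h := integral_exp_combination hb (1 + q / (1 - q)) (q / (1 - q)) 0
  rw [← hqd] at h
  unfold crossMass
  rw [← hqd]
  trans (1 + q / (1 - q)) * (1 - q) / b + q / (1 - q) + 0 * (q⁻¹ - 1) / b
  · rw [← h]
    congr 1; ext x
    unfold expNear expTail
    rw [← hqd]
    linear_combination (q / (1 - q)) * exp_mul_exp_neg (b * |x|)
  · field_simp
    ring

lemma integral_sq_tail {b : ℝ} (hb : 0 < b) :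
    ∫ x in Icc (-(1 / 2) : ℝ) (1 / 2), expTail b x ^ 2 = epsOne b := by
  obtain ⟨h0, h1⟩ := exp_neg_mem_Ioo hb
  set q := exp (-b) with hqd
  have hq : 0 < 1 - q := by linarith
  have h := integral_exp_combination hb ((q / (1 - q)) ^ 2) (2 * (q / (1 - q)) ^ 2)
    ((q / (1 - q)) ^ 2)
  rw [← hqd] at h
  unfold epsOne
  rw [← hqd]
  trans (q / (1 - q)) ^ 2 * (1 - q) / b + 2 * (q / (1 - q)) ^ 2 +
    (q / (1 - q)) ^ 2 * (q⁻¹ - 1) / b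
  · rw [← h]
    congr 1; ext x
    unfold expTail
    rw [← hqd]
    linear_combination (2 * (q / (1 - q)) ^ 2) * exp_mul_exp_neg (b * |x|)
  · field_simp
    ring

/-! ### The error on the unit cube -/

lemma half_le_norm_add_latticePoint {d : ℕ} {x : EuclideanSpace ℝ (Fin d)} (hx : x ∈ unitCube d)
    {n : Fin d → ℤ} (hn : n ≠ 0) : 1 / 2 ≤ ‖x + latticePoint n‖ := by
  obtain ⟨i, hi⟩ := Function.ne_iff.1 hn
  have h1 : (1 : ℝ) ≤ |(n i : ℝ)| := by exact_mod_cast Int.one_le_abs hi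
  have h2 : |x i| ≤ 1 / 2 := abs_le.2 (hx i)
  have h3 : ‖(x + latticePoint n) i‖ ≤ ‖x + latticePoint n‖ := PiLp.norm_apply_le _ i
  have h4 : (x + latticePoint n) i = x i + n i := by simp [latticePoint]
  rw [h4, norm_eq_abs] at h3
  have h5 := abs_sub_abs_le_abs_sub (n i : ℝ) (-x i)
  rw [abs_neg, sub_neg_eq_add, add_comm (n i : ℝ)] at h5
  linarith

lemma hasSum_exp_neg_sum_abs {d : ℕ} {b : ℝ} (hb : 0 < b) {x : EuclideanSpace ℝ (Fin d)}
    (hx : x ∈ unitCube d) :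
    HasSum (fun n : Fin d → ℤ => exp (-(b * ∑ i, |(x + latticePoint n) i|)))
      (∏ i, (expNear b (x i) + expTail b (x i))) := by
  have h := (hasSum_prod_fin (f := fun i n => exp (-(b * |x i + n|)))
    fun i => (hasSum_exp_neg_abs_add hb (hx i)).summable.norm).2
  simp only [fun i => (hasSum_exp_neg_abs_add hb (hx i)).tsum_eq] at h
  refine h.congr_fun fun n => ?_
  rw [← exp_sum, Finset.mul_sum, ← Finset.sum_neg_distrib]
  simp [latticePoint]

/-- The pointwise bound on the approximation error. -/
lemma norm_cov_sub_covApp_le {d : ℕ} (hd : 1 ≤ d) {ρ ν α : ℝ} (hν : 0 < ν) (hα : 0 < α)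
    (hρ : 0 ≤ ρ) {x : EuclideanSpace ℝ (Fin d)} (hx : x ∈ unitCube d) :
    ‖(cov d ρ ν α x : ℂ) - covApp d ρ ν α x‖ ≤ √(errorConst d ρ ν α / d) *
      (∏ i, (expNear (beta d ν α) (x i) + expTail (beta d ν α) (x i)) -
        ∏ i, expNear (beta d ν α) (x i)) := by
  classical
  have hb := beta_pos hd hα (ν := ν)
  set b := beta d ν α
  have hl0 : latticePoint (0 : Fin d → ℤ) = 0 := by ext i; simp [latticePoint]
  -- The `n = 0` term is removed from the full lattice sum: the exponential bound on the covariance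
  -- is available only away from the origin.
  have hsum := (hasSum_ite_sub_hasSum (hasSum_exp_neg_sum_abs hb hx) 0).mul_left
    √(errorConst d ρ ν α / d)
  have hle : ∀ n : Fin d → ℤ, (if n = 0 then 0 else cov d ρ ν α (x + latticePoint n)) ≤
      √(errorConst d ρ ν α / d) *
        (if n = 0 then 0 else exp (-(b * ∑ i, |(x + latticePoint n) i|))) := fun n => by
    split_ifs with hn
    · simp
    · exact cov_le_exp hd hν hα hρ (half_le_norm_add_latticePoint hx hn)
  have hnn : ∀ n : Fin d → ℤ, 0 ≤ if n = 0 then 0 else cov d ρ ν α (x + latticePoint n) :=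
    fun n => by split_ifs <;> simp [cov_nonneg hν hα hρ]
  have hs := hsum.summable.of_nonneg_of_le hnn hle
  have htot := hs.hasSum.add (hasSum_ite_eq (0 : Fin d → ℤ) (cov d ρ ν α x))
  have hcov : HasSum (fun n => cov d ρ ν α (x + latticePoint n))
      ((∑' n : Fin d → ℤ, if n = 0 then 0 else cov d ρ ν α (x + latticePoint n)) +
        cov d ρ ν α x) := by
    refine htot.congr_fun fun n => ?_
    by_cases hn : n = 0
    · simp [hn, hl0]
    · simp [hn]
  -- Domination by the exponential sum supplies the summability that Poisson summation requires; the
  -- term `C₀(x)` then cancels.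
  rw [covApp_eq_tsum hd hν hα hρ hcov.summable, hcov.tsum_eq, ← Complex.ofReal_sub,
    Complex.norm_real, sub_add_cancel_right, norm_neg, norm_of_nonneg (tsum_nonneg hnn)]
  have h := hasSum_le hle hs.hasSum hsum
  refine h.trans (le_of_eq ?_)
  rw [hl0, add_zero]
  congr 2
  simp only [expNear]
  rw [← exp_sum, Finset.mul_sum, ← Finset.sum_neg_distrib]

lemma unitCube_eq_preimage (d : ℕ) : unitCube d =
    (WithLp.ofLp : EuclideanSpace ℝ (Fin d) → Fin d → ℝ) ⁻¹'
      Set.pi univ fun _ => Icc (-(1 / 2) : ℝ) (1 / 2) := by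
  ext x; simp only [unitCube, mem_ofPred_eq, mem_preimage, mem_univ_pi]

lemma measurableSet_unitCube (d : ℕ) : MeasurableSet (unitCube d) := by
  rw [unitCube_eq_preimage]
  exact (MeasurableSet.univ_pi fun _ => measurableSet_Icc).preimage (by fun_prop)

lemma setIntegral_unitCube_prod {d : ℕ} {f : ℝ → ℝ} (hf : Continuous f) :
    IntegrableOn (fun x : EuclideanSpace ℝ (Fin d) => ∏ i, f (x i)) (unitCube d) ∧
    ∫ x in unitCube d, ∏ i, f (x i) = (∫ t in Icc (-(1 / 2) : ℝ) (1 / 2), f t) ^ d := by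
  have hmp := PiLp.volume_preserving_ofLp (Fin d)
  have hme := (MeasurableEquiv.toLp 2 (Fin d → ℝ)).symm.measurableEmbedding
  have hr : (volume : Measure (Fin d → ℝ)).restrict (Set.pi univ fun _ => Icc (-(1 / 2) : ℝ) (1 / 2))
      = Measure.pi fun _ => volume.restrict (Icc (-(1 / 2) : ℝ) (1 / 2)) :=
    Measure.restrict_pi_pi _ _
  rw [unitCube_eq_preimage]
  constructor
  · refine (hmp.integrableOn_comp_preimage hme (f := fun y => ∏ i, f (y i))).2 ?_
    rw [IntegrableOn, hr]
    exact Integrable.fintype_prod fun _ => hf.integrableOn_Icc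
  · refine (hmp.setIntegral_preimage_emb hme (fun y => ∏ i, f (y i)) _).trans ?_
    rw [hr, integral_fintype_prod_eq_pow, Fintype.card_fin]

lemma continuous_covApp {d : ℕ} (hd : 1 ≤ d) {ρ ν α : ℝ} (hν : 0 < ν) (hα : 0 < α) :
    Continuous (covApp d ρ ν α) := by
  unfold covApp
  refine continuous_tsum (fun k => ?_) (summable_norm_spectralDensity hd hν hα (ρ := ρ))
    fun k u => (norm_appTerm u k).le
  unfold appTerm
  fun_prop

lemma errorConst_nonneg (d : ℕ) {ρ ν α : ℝ} (hν : 0 < ν) (hα : 0 < α) :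
    0 ≤ errorConst d ρ ν α := by
  have := Gamma_pos_of_pos hν
  unfold errorConst
  split_ifs <;> positivity

/-- A majorant of the squared periodisation error dominates the squared approximation error. -/
lemma integral_sq_error_le {d : ℕ} (hd : 1 ≤ d) {ρ ν α : ℝ} (hν : 0 < ν) (hα : 0 < α)
    (hρ : 0 ≤ ρ) {W : EuclideanSpace ℝ (Fin d) → ℝ} (hW : IntegrableOn W (unitCube d))
    (hle : ∀ x, (∏ i, (expNear (beta d ν α) (x i) + expTail (beta d ν α) (x i)) -
        ∏ i, expNear (beta d ν α) (x i)) ^ 2 ≤ W x) :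
    IntegrableOn (fun x => ‖(cov d ρ ν α x : ℂ) - covApp d ρ ν α x‖ ^ 2) (unitCube d) ∧
    ∫ x in unitCube d, ‖(cov d ρ ν α x : ℂ) - covApp d ρ ν α x‖ ^ 2 ≤
      errorConst d ρ ν α / d * ∫ x in unitCube d, W x := by
  have hc : 0 ≤ errorConst d ρ ν α / d := div_nonneg (errorConst_nonneg d hν hα) (by positivity)
  have hpt : ∀ x ∈ unitCube d, ‖(cov d ρ ν α x : ℂ) - covApp d ρ ν α x‖ ^ 2 ≤
      errorConst d ρ ν α / d * W x := fun x hx => by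
    have h := norm_cov_sub_covApp_le hd hν hα hρ hx
    calc _ ≤ _ := pow_le_pow_left₀ (norm_nonneg _) h 2
      _ ≤ _ := by
        rw [mul_pow, sq_sqrt hc]
        exact mul_le_mul_of_nonneg_left (hle x) hc
  have hae : ∀ᵐ x ∂volume.restrict (unitCube d),
      ‖(cov d ρ ν α x : ℂ) - covApp d ρ ν α x‖ ^ 2 ≤ errorConst d ρ ν α / d * W x := by
    filter_upwards [ae_restrict_mem (measurableSet_unitCube d)] with x hx using hpt x hx
  have hm : AEStronglyMeasurable (fun x => ‖(cov d ρ ν α x : ℂ) - covApp d ρ ν α x‖ ^ 2)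
      (volume.restrict (unitCube d)) := by
    have h1 := (integrable_cov (d := d) (ρ := ρ) hν hα).ofReal (𝕜 := ℂ) |>.aestronglyMeasurable
    exact ((h1.sub (continuous_covApp hd hν hα).aestronglyMeasurable).norm.pow 2).restrict
  constructor
  · refine Integrable.mono' (hW.const_mul (errorConst d ρ ν α / d)) hm ?_
    filter_upwards [hae] with x hx
    rwa [norm_of_nonneg (by positivity)]
  · rw [← integral_const_mul]
    exact integral_mono_of_nonneg (ae_of_all _ fun x => by positivity) (hW.const_mul _) hae

end WhittleMatern

end

theorem propositionI2 (d : ℕ) (hd : 1 ≤ d) (ρ ν α : ℝ) (hν : 0 < ν) (hα : 0 < α)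
    (hρ0 : 0 ≤ ρ) (hρ : ρ ≤ WhittleMatern.rhoMax d ν α) :
    -- `C₀` is integrable, so that its Fourier transform `φ` is a genuine integral
    Integrable (WhittleMatern.cov d ρ ν α) ∧
    -- the series defining `C_{app,0}` converges absolutely
    (∀ u : EuclideanSpace ℝ (Fin d), Summable (WhittleMatern.appTerm d ρ ν α u)) ∧
    -- the squared error is integrable over the cube, and its integral obeys the bound
    IntegrableOn
      (fun x => ‖(WhittleMatern.cov d ρ ν α x : ℂ) - WhittleMatern.covApp d ρ ν α x‖ ^ 2)
      (WhittleMatern.unitCube d) ∧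
    ∫ x in WhittleMatern.unitCube d,
        ‖(WhittleMatern.cov d ρ ν α x : ℂ) - WhittleMatern.covApp d ρ ν α x‖ ^ 2
      ≤ WhittleMatern.errorConst d ρ ν α * WhittleMatern.eps d ν α := by
  open WhittleMatern in
  refine ⟨integrable_cov hν hα, fun u => summable_appTerm hd hν hα u, ?_⟩
  have hb := beta_pos hd hα (ν := ν)
  have hd' : (0 : ℝ) < d := by exact_mod_cast hd
  have hc := errorConst_nonneg d hν hα (ρ := ρ)
  by_cases h1 : d = 1
  · subst h1
    obtain ⟨hi, hv⟩ := setIntegral_unitCube_prod (d := 1) (f := fun t => expTail (beta 1 ν α) t ^ 2)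
      (by fun_prop)
    -- In one dimension `P - Q` is exactly `expTail`, so nothing is lost.
    obtain ⟨h2, h3⟩ := integral_sq_error_le hd hν hα hρ0 hi fun x => by simp
    refine ⟨h2, h3.trans (le_of_eq ?_)⟩
    rw [hv, integral_sq_tail hb]
    simp [eps]
  · obtain ⟨hi, hv⟩ := setIntegral_unitCube_prod (d := d)
      (f := fun t => (expNear (beta d ν α) t + expTail (beta d ν α) t) ^ 2) (by fun_prop)
    obtain ⟨hi', hv'⟩ := setIntegral_unitCube_prod (d := d)
      (f := fun t => (expNear (beta d ν α) t + expTail (beta d ν α) t) * expNear (beta d ν α) t)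
      (by fun_prop)
    -- The majorant is `P² - PQ`: as `0 ≤ Q ≤ P`, it exceeds `(P-Q)²` by `Q(P-Q) ≥ 0`, and both of
    -- its terms are products over coordinates.
    obtain ⟨h2, h3⟩ := integral_sq_error_le hd hν hα hρ0 (hi.sub hi') fun x => by
      have hle : ∏ i, expNear (beta d ν α) (x i) ≤
          ∏ i, (expNear (beta d ν α) (x i) + expTail (beta d ν α) (x i)) :=
        Finset.prod_le_prod (fun i _ => expNear_nonneg _ _)
          fun i _ => le_add_of_nonneg_right (expTail_nonneg hb _)
      have h0 : 0 ≤ ∏ i, expNear (beta d ν α) (x i) :=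
        Finset.prod_nonneg fun i _ => expNear_nonneg _ _
      simp only [Pi.sub_apply, Finset.prod_mul_distrib, Finset.prod_pow]
      nlinarith
    refine ⟨h2, h3.trans ?_⟩
    simp only [Pi.sub_apply]
    rw [integral_sub hi hi', hv, hv', integral_sq_periodised hb, integral_periodised_mul_near hb]
    have hmain := sqMass_pow_sub_crossMass_pow_le hb (show 2 ≤ d by omega)
    calc _ ≤ errorConst d ρ ν α / d * (d * (epsHead (beta d ν α) * sqMass (beta d ν α) ^ (d - 1))) :=
          mul_le_mul_of_nonneg_left hmain (by positivity)
      _ = errorConst d ρ ν α * (epsHead (beta d ν α) * sqMass (beta d ν α) ^ (d - 1)) := by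
          field_simp
      _ = _ := by rw [eps, if_neg h1]; rfl
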